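/- **Setting.** Let $\Omega$ be a finite nonempty set, $\Delta(\Omega)$ the set of probability measures on it, and call the nonempty subsets of $\Omega$ events. Let $\{\pi_A\}$ be a family of elements of $\Delta(\Omega)$ indexed by the events $A$; the prior is $\pi_\Omega$. For $\mu\in\Delta(\Omega)$ write $\mu(\cdot\mid A)$ for the Bayesian posterior given $A$. **RML updating.** A *probability assessment* is a pair $(\pi,\mathcal P)$ of a full-support $\pi\in\Delta(\Omega)$ and a partition $\mathcal P$ of $\Omega$. A closed convex set $\mathbb N\subseteq\Delta(\Omega)$ is *consistent* with it if $\pi\in\mathbb N$, if $\pi'(P)=\pi(P)$ for all $\pi'\in\mathbb N$ and $P\in\mathcal P$, and if for all $P\in\mathcal P$ and $\emptyset\ne D\subsetneq P$ some $\pi'\in\mathbb N$ has $\pi'(D)\ne\pi(D)$. Let $\mathbb N_A=\{\pi'\in\mathbb N:\pi'(A)=\max_{\pi''\in\mathbb N}\pi''(A)\}$. The family $\{\pi_A\}$ *arises from RML updating* with $(\pi,\mathcal P)$ and a consistent $\mathbb N$ if, for every event $A$, $\pi_A$ is the unique minimizer of $q\mapsto-\sum_{\omega\in A}\pi(\omega\mid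 A)\ln\frac{q(\omega)}{\pi(\omega\mid A)}$ (where $\ln 0=-\infty$) over $\{\pi'(\cdot\mid A):\pi'\in\mathbb N_A\}$. The set $\mathbb N$ is *rich* if: 1. for all $P\in\mathcal P$ and $\emptyset\neq D\subsetneq P$ there are $\pi',\pi''\in\mathbb N$ with $\pi'(D)<\pi(D)<\pi''(D)$; 2. for every event $A$ there is $\pi'\in\mathbb N_A$ with $\pi'(\omega)/\pi'(\omega')=\pi(\omega)/\pi(\omega')$ for all $P\in\mathcal P$ and $\omega,\omega'\in A\cap P$; 3. for all $P\in\mathcal P$ and $D_1\subseteq\dots\subseteq D_m\subseteq P$ some $\pi'\in\mathbb N$ satisfies $\pi'(D_i)=\max_{\pi''\in\mathbb N}\pi''(D_i)$ for all $i$; 4. for all $\pi',\pi''\in\mathbb N$ and $P\in\mathcal P$, $\mathbb N$ contains a measure equal to $\pi'$ on $P$ and to $\pi''$ on $P^c$, and a measure equal to $\pi''$ on $P$ and to $\pi'$ on $P^c$. **Axioms.** A set $E\subseteq\Omega$ is *ideal* if $\pi_E(\omega)=\pi_A(\omega\mid E)$ for all events $A\supseteq E$ and all $\omega\in E$, and *symmetrically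 ideal* if $E$ and $E^c$ are ideal ($\emptyset$ and $\Omega$ are symmetrically ideal); $\mathcal I$ is the collection of symmetrically ideal sets and $\mathcal P_{\mathcal I}$ the collection of its minimal nonempty members, which is the unique partition generating $\mathcal I$ when $\mathcal I$ is an algebra. Put $O_P(A)=\pi_A(P)/(1-\pi_A(P))$. The axioms are: - *Regularity*: for every event $A$, $\pi_A(\omega)>0$ for $\omega\in A$, and $\pi_A(A)=1$. - *$\mathcal I$-Algebra*: $E,E'\in\mathcal I$ implies $E\cap E'\in\mathcal I$. - *Betweenness*: $\pi_A(P)\ge\pi_{A\setminus D}(P)\ge\pi_A(P\mid A\setminus D)$ for all events $A$, $P\in\mathcal P_{\mathcal I}$ and $D\subsetneq A\cap P$. - *Submodularity*: $O_P(A)+O_P(A\setminus(D_1\cup D_2))\le O_P(A\setminus D_1)+O_P(A\setminus D_2)$ for all $P\in\mathcal P_{\mathcal I}$, $A$ with $A\setminus P\ne\emptyset$, and disjoint $D_1,D_2\subseteq P$. - *Log-modularity*: $\ln O_P(A)+\ln O_P(A\setminus(D_1\cup D_2))=\ln O_P(A\setminus D_1)+\ln O_P(A\setminus D_2)$ for all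 $P\in\mathcal P_{\mathcal I}$, $A$ with $A\cap P\ne\emptyset\ne A\cap P^c$, $D_1\subsetneq A\cap P$ and $D_2\subsetneq A\cap P^c$. - *Idealness*: every $D\subsetneq P$ with $P\in\mathcal P_{\mathcal I}$ is ideal. **Revealed set.** For $P\in\mathcal P_{\mathcal I}$ and $D\subseteq P$ let $\bar\pi_P(D)=\dfrac{\pi_{P^c\cup D}(P)\,\pi_\Omega(P^c)}{\pi_{P^c\cup D}(P^c)}$ (used when $P\neq\Omega$). For an ordering of the states of $P$, the *greedy prior* gives each $\omega\in P$ the mass $\bar\pi_P(S\cup\{\omega\})-\bar\pi_P(S)$, where $S$ is the set of states of $P$ before $\omega$, and equals $\pi_\Omega$ outside $P$. Let $\mathbb N^{*}$ be the set of $q\in\Delta(\Omega)$ such that for every $P\in\mathcal P_{\mathcal I}$ the restriction $q|_P$ lies in the convex hull of the restrictions to $P$ of the greedy priors for all orderings of $P$. **Theorem 1.** (a) $\{\pi_A\}$ satisfies the six axioms if and only if it arises from RML updating with some probability assessment $(\pi,\mathcal P)$ and some consistent, rich $\mathbb N$. (b) The representation is unique as long as $\mathcal P\ne\{\Omega\}$: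 any two triples $(\pi,\mathcal P,\mathbb N)$ as in (a) for the same family, both with $\mathcal P\neq\{\Omega\}$, coincide. In fact, for any such triple, $\pi=\pi_\Omega$, $\mathcal P=\mathcal P_{\mathcal I}$ and $\mathbb N=\mathbb N^{*}$. (c) If $\{\pi_A\}$ satisfies the axioms and $\mathcal P_{\mathcal I}\ne\{\Omega\}$, then it arises from RML updating with the assessment $(\pi_\Omega,\mathcal P_{\mathcal I})$ and the consistent, rich set $\mathbb N^{*}$. -/

import Mathlib

open Finset

namespace RMLUpdating

section Definitions

variable {Ω : Type*} [Fintype Ω] [DecidableEq Ω]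

/-! A probability measure on the finite state space `Ω` is an element `p : Ω → ℝ` of the simplex
`stdSimplex ℝ Ω`.  A family of posteriors is a map `post : Finset Ω → Ω → ℝ`; only its values at
nonempty events matter, and `post univ` is the prior. -/

/-- The probability `p(A)` of the event `A`. -/
def prob (p : Ω → ℝ) (A : Finset Ω) : ℝ := ∑ ω ∈ A, p ω

/-- The Bayesian posterior `p(· | A)`. -/
noncomputable def bayes (p : Ω → ℝ) (A : Finset Ω) : Ω → ℝ :=
  fun ω => if ω ∈ A then p ω / prob p A else 0

/-! ### The model -/

/-- `N` is a closed and convex set of plausible priors that is consistent with the probability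
assessment `(p, Q)`, where the benchmark prior `p` has full support and `Q` is the partition of
minimal unambiguous events. -/
structure IsConsistent (p : Ω → ℝ) (Q : Finpartition (univ : Finset Ω)) (N : Set (Ω → ℝ)) :
    Prop where
  prior_mem : p ∈ stdSimplex ℝ Ω
  full_support : ∀ ω, 0 < p ω
  subset_simplex : N ⊆ stdSimplex ℝ Ω
  closed : IsClosed N
  convex : Convex ℝ N
  benchmark_mem : p ∈ N
  agree : ∀ q ∈ N, ∀ P ∈ Q.parts, prob q P = prob p P
  ambiguous : ∀ P ∈ Q.parts, ∀ D, D.Nonempty → D ⊂ P → ∃ q ∈ N, prob q D ≠ prob p D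

/-- `N_A`: the priors in `N` that maximize the likelihood of `A`. -/
def maxLik (N : Set (Ω → ℝ)) (A : Finset Ω) : Set (Ω → ℝ) :=
  {q | q ∈ N ∧ ∀ r ∈ N, prob r A ≤ prob q A}

/-- `B(N_A)`: the Bayesian posteriors given `A` of the priors in `N_A`. -/
noncomputable def maxLikPosteriors (N : Set (Ω → ℝ)) (A : Finset Ω) : Set (Ω → ℝ) :=
  (fun q => bayes q A) '' maxLik N A

open Classical in
/-- The Kullback-Leibler divergence `-∑_{ω ∈ A} p(ω) ln (q(ω) / p(ω))` of measures carried by `A`,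
equal to `+∞` if `q` vanishes at a state of `A` to which `p` gives positive probability. -/
noncomputable def klDivOn (A : Finset Ω) (p q : Ω → ℝ) : EReal :=
  if ∃ ω ∈ A, p ω ≠ 0 ∧ q ω = 0 then ⊤
  else ((-∑ ω ∈ A, p ω * Real.log (q ω / p ω) : ℝ) : EReal)

/-- The set of minimizers of `D_KL(p(· | A) ‖ ·)` over `B(N_A)`. -/
def klArgmin (p : Ω → ℝ) (N : Set (Ω → ℝ)) (A : Finset Ω) : Set (Ω → ℝ) :=
  {q | q ∈ maxLikPosteriors N A ∧
    ∀ r ∈ maxLikPosteriors N A, klDivOn A (bayes p A) q ≤ klDivOn A (bayes p A) r}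

/-- The posteriors are given by robust maximum likelihood updating with the probability assessment
`(p, Q)` and the consistent set of plausible priors `N`: for every event `A`, the posterior
`post A` is the minimizer of the divergence over `B(N_A)`. -/
structure IsRML (post : Finset Ω → Ω → ℝ) (p : Ω → ℝ) (Q : Finpartition (univ : Finset Ω))
    (N : Set (Ω → ℝ)) : Prop where
  consistent : IsConsistent p Q N
  posterior : ∀ A : Finset Ω, A.Nonempty → klArgmin p N A = {post A}

/-- Richness of a set of plausible priors. -/
structure IsRich (p : Ω → ℝ) (Q : Finpartition (univ : Finset Ω)) (N : Set (Ω → ℝ)) : Prop where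
  non_extreme : ∀ P ∈ Q.parts, ∀ D, D.Nonempty → D ⊂ P →
    ∃ q ∈ N, ∃ r ∈ N, prob q D < prob p D ∧ prob p D < prob r D
  prior_coherent : ∀ A : Finset Ω, A.Nonempty → ∃ q ∈ maxLik N A,
    ∀ P ∈ Q.parts, ∀ ω ∈ A ∩ P, ∀ ω' ∈ A ∩ P, q ω / q ω' = p ω / p ω'
  chain_coherent : ∀ P ∈ Q.parts, ∀ (m : ℕ) (D : Fin m → Finset Ω), Monotone D →
    (∀ i, D i ⊆ P) → ∃ q ∈ N, ∀ i, ∀ r ∈ N, prob r (D i) ≤ prob q (D i)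
  rectangular : ∀ q ∈ N, ∀ r ∈ N, ∀ P ∈ Q.parts,
    ∃ s ∈ N, ∃ t ∈ N, (∀ ω ∈ P, s ω = q ω) ∧ (∀ ω ∈ Pᶜ, s ω = r ω) ∧
      (∀ ω ∈ P, t ω = r ω) ∧ (∀ ω ∈ Pᶜ, t ω = q ω)

/-- RML updating with a rich set of plausible priors. -/
def IsRichRML (post : Finset Ω → Ω → ℝ) (p : Ω → ℝ) (Q : Finpartition (univ : Finset Ω))
    (N : Set (Ω → ℝ)) : Prop :=
  IsRML post p Q N ∧ IsRich p Q N

/-! ### The axioms -/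

/-- Regularity. -/
def Regularity (post : Finset Ω → Ω → ℝ) : Prop :=
  ∀ A : Finset Ω, A.Nonempty → (∀ ω ∈ A, 0 < post A ω) ∧ prob (post A) A = 1

/-- The event `E` is ideal: `post E` is the Bayesian posterior of `post A` given `E`, for every
event `A ⊇ E`. -/
def IsIdealEvent (post : Finset Ω → Ω → ℝ) (E : Finset Ω) : Prop :=
  ∀ A : Finset Ω, A.Nonempty → E ⊆ A → ∀ ω ∈ E, post E ω = bayes (post A) E ω

/-- The event `E` is symmetrically ideal.  (For `∅` and `univ` this holds for every family of
probability measures.)  The collection of these events is `ℐ`. -/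
def IsSymmIdeal (post : Finset Ω → Ω → ℝ) (E : Finset Ω) : Prop :=
  IsIdealEvent post E ∧ IsIdealEvent post Eᶜ

/-- `ℐ`-Algebra. -/
def IAlgebra (post : Finset Ω → Ω → ℝ) : Prop :=
  ∀ E E' : Finset Ω, IsSymmIdeal post E → IsSymmIdeal post E' → IsSymmIdeal post (E ∩ E')

/-- `𝒫_ℐ`: the minimal nonempty symmetrically ideal events.  If these form an algebra, `𝒫_ℐ` is
the unique partition that generates it, see `exists_partition_generating` and
`parts_eq_of_generating`. -/
def revealedPartition (post : Finset Ω → Ω → ℝ) : Set (Finset Ω) :=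
  {P | Minimal (fun E => E.Nonempty ∧ IsSymmIdeal post E) P}

/-- Betweenness. -/
def Betweenness (post : Finset Ω → Ω → ℝ) : Prop :=
  ∀ A : Finset Ω, A.Nonempty → ∀ P ∈ revealedPartition post, ∀ D, D ⊂ A ∩ P →
    prob (post (A \ D)) P ≤ prob (post A) P ∧
      prob (bayes (post A) (A \ D)) P ≤ prob (post (A \ D)) P

/-- The odds `O_B(A)` for `B` when `A` is realized. -/
noncomputable def odds (post : Finset Ω → Ω → ℝ) (B A : Finset Ω) : ℝ :=
  prob (post A) B / (1 - prob (post A) B)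

/-- Submodularity. -/
def Submodularity (post : Finset Ω → Ω → ℝ) : Prop :=
  ∀ A : Finset Ω, ∀ P ∈ revealedPartition post, (A \ P).Nonempty →
    ∀ D₁ D₂ : Finset Ω, D₁ ⊆ P → D₂ ⊆ P → D₁ ∩ D₂ = ∅ →
      odds post P A + odds post P (A \ (D₁ ∪ D₂)) ≤ odds post P (A \ D₁) + odds post P (A \ D₂)

/-- Log-modularity. -/
def LogModularity (post : Finset Ω → Ω → ℝ) : Prop :=
  ∀ A : Finset Ω, ∀ P ∈ revealedPartition post, (A ∩ P).Nonempty → (A ∩ Pᶜ).Nonempty →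
    ∀ D₁ D₂ : Finset Ω, D₁ ⊂ A ∩ P → D₂ ⊂ A ∩ Pᶜ →
      Real.log (odds post P A) + Real.log (odds post P (A \ (D₁ ∪ D₂))) =
        Real.log (odds post P (A \ D₁)) + Real.log (odds post P (A \ D₂))

/-- Idealness. -/
def Idealness (post : Finset Ω → Ω → ℝ) : Prop :=
  ∀ P ∈ revealedPartition post, ∀ D, D ⊂ P → IsIdealEvent post D

/-- The six axioms. -/
structure SatisfiesAxioms (post : Finset Ω → Ω → ℝ) : Prop where
  regularity : Regularity post
  algebra : IAlgebra post
  betweenness : Betweenness post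
  submodularity : Submodularity post
  log_modularity : LogModularity post
  idealness : Idealness post

/-! ### The set of plausible priors revealed by the posteriors -/

/-- The upper probability of `D ⊆ P` that is revealed by the posterior given `Pᶜ ∪ D`. -/
noncomputable def revealedUpper (post : Finset Ω → Ω → ℝ) (P D : Finset Ω) : ℝ :=
  prob (post (Pᶜ ∪ D)) P * prob (post univ) Pᶜ / prob (post (Pᶜ ∪ D)) Pᶜ

/-- The greedy prior for `P` and the order in which `σ` ranks the states of `P`: each state of `P`
receives the increment of the revealed upper probability when it is added to the states of `P`
before it.  Outside `P` it is the prior. -/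
noncomputable def greedyPrior (post : Finset Ω → Ω → ℝ) (P : Finset Ω)
    (σ : Ω ≃ Fin (Fintype.card Ω)) : Ω → ℝ :=
  fun ω => if ω ∈ P then
      revealedUpper post P {ω' ∈ P | σ ω' ≤ σ ω} - revealedUpper post P {ω' ∈ P | σ ω' < σ ω}
    else post univ ω

/-- The probability measures whose restriction to each `P` in `𝒫_ℐ` is a convex combination of
restrictions to `P` of greedy priors for `P`. -/
def greedySet (post : Finset Ω → Ω → ℝ) : Set (Ω → ℝ) :=
  {q | q ∈ stdSimplex ℝ Ω ∧ ∀ P ∈ revealedPartition post,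
    (fun ω : P => q ω) ∈
      convexHull ℝ (Set.range fun (σ : Ω ≃ Fin (Fintype.card Ω)) (ω : P) => greedyPrior post P σ ω)}

/-! ### Well-definedness of `𝒫_ℐ` -/

/-- The partition `Q` generates the collection of symmetrically ideal events. -/
def Generates (post : Finset Ω → Ω → ℝ) (Q : Finpartition (univ : Finset Ω)) : Prop :=
  ∀ E : Finset Ω, IsSymmIdeal post E ↔ ∃ S ⊆ Q.parts, E = S.biUnion id

theorem parts_eq_of_generating {post : Finset Ω → Ω → ℝ} {Q : Finpartition (univ : Finset Ω)}
    (hQ : Generates post Q) : (Q.parts : Set (Finset Ω)) = revealedPartition post := by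
  have key : ∀ P ∈ Q.parts, IsSymmIdeal post P := fun P hP =>
    (hQ P).2 ⟨{P}, by simpa using hP, by simp⟩
  have sub : ∀ E, E.Nonempty → IsSymmIdeal post E → ∃ P ∈ Q.parts, P ⊆ E := by
    intro E hE hI
    obtain ⟨S, hS, rfl⟩ := (hQ E).1 hI
    obtain ⟨ω, hω⟩ := hE
    obtain ⟨P, hP, _⟩ := Finset.mem_biUnion.1 hω
    exact ⟨P, hS hP, fun x hx => Finset.mem_biUnion.2 ⟨P, hP, hx⟩⟩
  ext P
  constructor
  · intro hP
    refine ⟨⟨Q.nonempty_of_mem_parts hP, key P hP⟩, ?_⟩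
    rintro E ⟨hE, hI⟩ hEP
    obtain ⟨P', hP', hsub⟩ := sub E hE hI
    obtain ⟨ω, hω⟩ := Q.nonempty_of_mem_parts hP'
    have : P' = P := Q.eq_of_mem_parts hP' hP hω (hEP (hsub hω))
    exact this ▸ hsub
  · rintro ⟨⟨hne, hI⟩, hmin⟩
    obtain ⟨P', hP', hsub⟩ := sub P hne hI
    have : P ⊆ P' := hmin ⟨Q.nonempty_of_mem_parts hP', key P' hP'⟩ hsub
    rw [subset_antisymm this hsub]
    exact hP'

theorem exists_partition_generating {post : Finset Ω → Ω → ℝ}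
    (hpost : ∀ A : Finset Ω, A.Nonempty → post A ∈ stdSimplex ℝ Ω) (hI : IAlgebra post) :
    ∃ Q : Finpartition (univ : Finset Ω), Generates post Q := by
  classical
  have huniv : IsSymmIdeal post univ := by
    refine ⟨fun A hA hE ω _ => ?_, fun A _ _ ω hω => by simp at hω⟩
    obtain rfl : A = univ := Finset.univ_subset_iff.1 hE
    simp [bayes, prob, (hpost univ hA).2]
  have hcompl : ∀ E, IsSymmIdeal post E → IsSymmIdeal post Eᶜ := fun E h =>
    ⟨h.2, by rw [compl_compl]; exact h.1⟩
  let cell : Ω → Finset Ω := fun ω => ({E | IsSymmIdeal post E ∧ ω ∈ E} : Finset (Finset Ω)).inf id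
  have mem_cell : ∀ ω x, x ∈ cell ω ↔ ∀ E, IsSymmIdeal post E → ω ∈ E → x ∈ E := by
    intro ω x
    simp [cell, Finset.mem_inf]
  have cellI : ∀ ω, IsSymmIdeal post (cell ω) := by
    intro ω
    refine Finset.inf_induction (p := fun E => IsSymmIdeal post E) huniv
      (fun E hE E' hE' => hI E E' hE hE') ?_
    intro E hE
    exact (Finset.mem_filter.1 hE).2.1
  have self : ∀ ω, ω ∈ cell ω := fun ω => (mem_cell ω ω).2 fun _ _ h => h
  have cell_eq : ∀ ω x, x ∈ cell ω → cell x = cell ω := by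
    intro ω x hx
    have hωx : ω ∈ cell x := by
      by_contra h
      have := (mem_cell ω x).1 hx _ (hcompl _ (cellI x)) (Finset.mem_compl.2 h)
      exact Finset.mem_compl.1 this (self x)
    ext y
    rw [mem_cell, mem_cell]
    exact ⟨fun h E hE hω => h E hE ((mem_cell ω x).1 hx E hE hω),
      fun h E hE hx' => h E hE ((mem_cell x ω).1 hωx E hE hx')⟩
  let Q : Finpartition (univ : Finset Ω) := Finpartition.ofExistsUnique (univ.image cell)
    (fun _ _ => Finset.subset_univ _)
    (fun a _ => ⟨cell a, ⟨Finset.mem_image_of_mem _ (Finset.mem_univ a), self a⟩, by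
      rintro t ⟨ht, hat⟩
      obtain ⟨b, _, rfl⟩ := Finset.mem_image.1 ht
      exact (cell_eq b a hat).symm⟩)
    (fun h => by
      obtain ⟨b, _, hb⟩ := Finset.mem_image.1 h
      exact absurd (self b) (by simp [hb]))
  refine ⟨Q, fun E => ⟨fun hE => ⟨E.image cell, ?_, ?_⟩, ?_⟩⟩
  · exact Finset.image_subset_image (Finset.subset_univ E)
  · ext x
    simp only [Finset.mem_biUnion, Finset.mem_image, id]
    constructor
    · exact fun hx => ⟨cell x, ⟨x, hx, rfl⟩, self x⟩
    · rintro ⟨_, ⟨a, ha, rfl⟩, hx⟩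
      exact (mem_cell a x).1 hx E hE ha
  · rintro ⟨S, hS, rfl⟩
    have hP : ∀ P ∈ S, IsSymmIdeal post P := by
      intro P hP
      obtain ⟨b, _, rfl⟩ := Finset.mem_image.1 (hS hP)
      exact cellI b
    have hinf : IsSymmIdeal post (S.inf fun P => Pᶜ) :=
      Finset.inf_induction (p := fun E => IsSymmIdeal post E) huniv
        (fun E hE E' hE' => hI E E' hE hE') (fun P h => hcompl P (hP P h))
    have heq : S.biUnion id = (S.inf fun P => Pᶜ)ᶜ := by
      ext x
      simp
    rw [heq]
    exact hcompl _ hinf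

end Definitions

end RMLUpdating

open RMLUpdating

set_option linter.unusedSectionVars false

namespace RMLUpdating

variable {Ω : Type*} [Fintype Ω] [DecidableEq Ω]

/-! ### Probabilities of events -/

/-! Everything is carried by one set function `u` on the subsets of cells, the upper probability,
with the properties listed in `IsUpper`. For a rich `N`, rectangularity lets the likelihood of `A`
be maximized cell by cell, so every prior in `N_A` gives `A ∩ P` the mass `u (A ∩ P)`. Prior
coherence supplies a maximizer proportional to `p` inside the cells, and `ln x ≤ x - 1` makes its
Bayesian posterior the unique minimizer of the divergence. Hence the posteriors have the explicit
form `Represents`.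

The axioms translate the properties of `u`. The odds of `P` are `u (A ∩ P)` over a quantity that
depends on `A \ P` only, which is Log-modularity. Betweenness expresses that `u` increases and `u /
p` decreases, Submodularity that `u` is submodular. Since `u > p` on nonempty proper subsets of a
cell, an event that splits a cell cannot be symmetrically ideal when states exist outside that cell
(`Represents.generates`); this identifies the partition.

Conversely, the odds at `Pᶜ ∪ D` define `u D`, and the axioms give `IsUpper` (`isUpper_cellUpper`),
strictness being the minimality of the cells. Log-modularity then determines the posterior at every
event by completing cells one at a time (`prob_cell_eq`), and the base polytope of `u` is a rich set
that yields these posteriors (`IsUpper.isRichRML_basePolytope`).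

For uniqueness, `u` is read off the posteriors, and chain coherence puts every greedy vector, cell
by cell, into `N`. The base polytope of a submodular function is the hull of its greedy vectors, so
convexity and rectangularity force `N` to be the whole polytope (`IsRich.eq_basePolytope`). The
partition `{univ}` is exceptional: updating is then Bayesian, and the partition into singletons
represents it as well. -/

@[simp] theorem prob_empty (p : Ω → ℝ) : prob p ∅ = 0 := by simp [prob]

theorem prob_union {p : Ω → ℝ} {A B : Finset Ω} (h : Disjoint A B) :
    prob p (A ∪ B) = prob p A + prob p B := Finset.sum_union h

theorem prob_sdiff {p : Ω → ℝ} {A B : Finset Ω} (h : B ⊆ A) :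
    prob p (A \ B) = prob p A - prob p B :=
  eq_sub_of_add_eq (Finset.sum_sdiff h)

theorem prob_mono {p : Ω → ℝ} (hp : ∀ ω, 0 ≤ p ω) {A B : Finset Ω} (h : A ⊆ B) :
    prob p A ≤ prob p B :=
  Finset.sum_le_sum_of_subset_of_nonneg h fun ω _ _ => hp ω

theorem prob_nonneg {p : Ω → ℝ} (hp : ∀ ω, 0 ≤ p ω) (A : Finset Ω) : 0 ≤ prob p A :=
  Finset.sum_nonneg fun ω _ => hp ω

theorem prob_pos {p : Ω → ℝ} (hp : ∀ ω, 0 < p ω) {A : Finset Ω} (hA : A.Nonempty) :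
    0 < prob p A :=
  Finset.sum_pos (fun ω _ => hp ω) hA

theorem prob_univ {p : Ω → ℝ} (hp : p ∈ stdSimplex ℝ Ω) : prob p univ = 1 := hp.2

theorem prob_compl {p : Ω → ℝ} (hp : p ∈ stdSimplex ℝ Ω) (A : Finset Ω) :
    prob p Aᶜ = 1 - prob p A := by
  rw [Finset.compl_eq_univ_sdiff, prob_sdiff (Finset.subset_univ A), prob_univ hp]

theorem prob_congr {p q : Ω → ℝ} {A : Finset Ω} (h : ∀ ω ∈ A, p ω = q ω) : prob p A = prob q A :=
  Finset.sum_congr rfl h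

theorem prob_mul_left {p : Ω → ℝ} {A : Finset Ω} (c : ℝ) :
    prob (fun ω => c * p ω) A = c * prob p A := (Finset.mul_sum _ _ _).symm

theorem prob_inter_of_support {q : Ω → ℝ} {A : Finset Ω} (h : ∀ ω, ω ∉ A → q ω = 0)
    (B : Finset Ω) : prob q B = prob q (A ∩ B) := by
  refine (Finset.sum_subset Finset.inter_subset_right fun ω hω hn => h ω fun hA => hn ?_).symm
  exact Finset.mem_inter.2 ⟨hA, hω⟩

theorem sum_eq_sum_parts (Q : Finpartition (univ : Finset Ω)) (f : Ω → ℝ) (A : Finset Ω) :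
    ∑ ω ∈ A, f ω = ∑ P ∈ Q.parts, ∑ ω ∈ A ∩ P, f ω := by
  have h : A = Q.parts.biUnion fun P => A ∩ P := by
    ext x
    simp only [Finset.mem_biUnion, Finset.mem_inter]
    refine ⟨fun hx => ?_, fun ⟨_, _, hx, _⟩ => hx⟩
    obtain ⟨P, hP, hxP⟩ := Q.exists_mem (Finset.mem_univ x)
    exact ⟨P, hP, hx, hxP⟩
  conv_lhs => rw [h]
  refine Finset.sum_biUnion fun P hP P' hP' hne => ?_
  exact (Q.disjoint hP hP' hne).mono Finset.inter_subset_right Finset.inter_subset_right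

theorem prob_eq_sum_parts (Q : Finpartition (univ : Finset Ω)) (p : Ω → ℝ) (A : Finset Ω) :
    prob p A = ∑ P ∈ Q.parts, prob p (A ∩ P) := sum_eq_sum_parts Q p A

theorem bayes_congr {q r : Ω → ℝ} {A : Finset Ω} (h : ∀ ω ∈ A, q ω = r ω) :
    bayes q A = bayes r A := by
  funext ω
  by_cases hω : ω ∈ A
  · simp [bayes, hω, h ω hω, prob_congr h]
  · simp [bayes, hω]

theorem bayes_univ {p : Ω → ℝ} (hp : p ∈ stdSimplex ℝ Ω) : bayes p univ = p := by
  funext ω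
  simp [bayes, prob_univ hp]

/-! ### Minimizers of the divergence -/

section Divergence

variable {Q : Finpartition (univ : Finset Ω)} {p q r : Ω → ℝ} {A : Finset Ω}

/-- First-order condition of the minimization: `p / q` is constant on each `A ∩ P`, so the sum there
is a multiple of the mass difference between `r` and `q`, which is zero. -/
theorem sum_mul_div_sub_one_eq_zero (hq : ∀ ω ∈ A, 0 < q ω)
    (hprop : ∀ P ∈ Q.parts, ∀ ω ∈ A ∩ P, q ω = prob q (A ∩ P) / prob p (A ∩ P) * p ω)
    (hmass : ∀ P ∈ Q.parts, prob r (A ∩ P) = prob q (A ∩ P)) :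
    ∑ ω ∈ A, p ω * (r ω / q ω - 1) = 0 := by
  rw [sum_eq_sum_parts Q]
  refine Finset.sum_eq_zero fun P hP => ?_
  have h : ∀ ω ∈ A ∩ P, p ω * (r ω / q ω - 1) =
      (prob q (A ∩ P) / prob p (A ∩ P))⁻¹ * (r ω - q ω) := by
    intro ω hω
    have hqω := hq ω (Finset.mem_inter.1 hω).1
    have e := hprop P hP ω hω
    set c := prob q (A ∩ P) / prob p (A ∩ P)
    have hc : c ≠ 0 := by rintro h; rw [h, zero_mul] at e; exact hqω.ne' e
    have : p ω = c⁻¹ * q ω := by rw [e]; field_simp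
    rw [this]
    field_simp
  rw [Finset.sum_congr rfl h, ← Finset.mul_sum, Finset.sum_sub_distrib]
  have := hmass P hP
  unfold prob at this
  rw [this, sub_self, mul_zero]

theorem klDivOn_eq_of_pos {L : ℝ} (hL : 0 < L) (hr : ∀ ω ∈ A, 0 < r ω) (hrL : prob r A = L) :
    klDivOn A (bayes p A) (bayes r A) =
      ((-∑ ω ∈ A, p ω / prob p A * Real.log (r ω / L / (p ω / prob p A)) : ℝ) : EReal) := by
  rw [klDivOn, if_neg]
  · congr 2
    refine Finset.sum_congr rfl fun ω hω => ?_
    simp [bayes, hω, hrL]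
  · rintro ⟨ω, hω, -, h⟩
    simp only [bayes, hω, if_true, hrL] at h
    exact (div_pos (hr ω hω) hL).ne' h

theorem klDivOn_eq_top (hp : ∀ ω, 0 < p ω) {ω : Ω} (hω : ω ∈ A) (hr : r ω = 0) :
    klDivOn A (bayes p A) (bayes r A) = ⊤ := by
  rw [klDivOn, if_pos]
  refine ⟨ω, hω, ?_, by simp [bayes, hr]⟩
  simp only [bayes, hω, if_true]
  exact (div_pos (hp ω) (prob_pos hp ⟨ω, hω⟩)).ne'

/-- A likelihood maximizer that is proportional to the benchmark `p` on each cell is the unique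
minimizer of the divergence, if all likelihood maximizers agree on the cells. -/
theorem klArgmin_eq_singleton {N : Set (Ω → ℝ)} (hp : ∀ ω, 0 < p ω) (hA : A.Nonempty)
    (hN : N ⊆ stdSimplex ℝ Ω) (hqN : q ∈ maxLik N A) (hq : ∀ ω ∈ A, 0 < q ω)
    (hprop : ∀ P ∈ Q.parts, ∀ ω ∈ A ∩ P, q ω = prob q (A ∩ P) / prob p (A ∩ P) * p ω)
    (hmass : ∀ r ∈ maxLik N A, ∀ P ∈ Q.parts, prob r (A ∩ P) = prob q (A ∩ P)) :
    klArgmin p N A = {bayes q A} := by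
  have hL : 0 < prob q A := Finset.sum_pos hq hA
  have hpA := prob_pos hp hA
  have hrL : ∀ r ∈ maxLik N A, prob r A = prob q A := fun r hr => by
    rw [prob_eq_sum_parts Q r, prob_eq_sum_parts Q q]
    exact Finset.sum_congr rfl (hmass r hr)
  -- All maximizers have the same likelihood on `A`, so the normalizations cancel from the
  -- difference of two divergences.
  have diff : ∀ r ∈ maxLik N A, (∀ ω ∈ A, 0 < r ω) →
      ∑ ω ∈ A, p ω / prob p A * Real.log (r ω / prob q A / (p ω / prob p A)) -
        ∑ ω ∈ A, p ω / prob p A * Real.log (q ω / prob q A / (p ω / prob p A)) =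
      (∑ ω ∈ A, p ω * Real.log (r ω / q ω)) / prob p A := by
    intro r _ hr
    rw [← Finset.sum_sub_distrib, Finset.sum_div]
    refine Finset.sum_congr rfl fun ω hω => ?_
    have h1 := (hr ω hω).ne'
    have h2 := (hq ω hω).ne'
    have h3 := (hp ω).ne'
    rw [Real.log_div (by positivity) (by positivity), Real.log_div h1 hL.ne',
      Real.log_div (x := q ω / _) (by positivity) (by positivity), Real.log_div h2 hL.ne',
      Real.log_div h1 h2]
    ring
  have term : ∀ r : Ω → ℝ, (∀ ω ∈ A, 0 < r ω) → ∀ ω ∈ A,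
      p ω * Real.log (r ω / q ω) ≤ p ω * (r ω / q ω - 1) := fun r hr ω hω =>
    mul_le_mul_of_nonneg_left (Real.log_le_sub_one_of_pos (div_pos (hr ω hω) (hq ω hω))) (hp ω).le
  have pos_or : ∀ r ∈ maxLik N A, (∀ ω ∈ A, 0 < r ω) ∨ ∃ ω ∈ A, r ω = 0 := by
    intro r hr
    by_cases h : ∃ ω ∈ A, r ω = 0
    · exact Or.inr h
    · push Not at h
      exact Or.inl fun ω hω => lt_of_le_of_ne ((hN hr.1).1 ω) (h ω hω).symm
  ext x
  constructor
  · rintro ⟨⟨r, hr, rfl⟩, hmin⟩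
    have hle := hmin _ ⟨q, hqN, rfl⟩
    have hrpos : ∀ ω ∈ A, 0 < r ω := by
      rcases pos_or r hr with h | ⟨ω, hω, h0⟩
      · exact h
      · rw [klDivOn_eq_top hp hω h0, klDivOn_eq_of_pos hL hq rfl, top_le_iff] at hle
        exact absurd hle (EReal.coe_ne_top _)
    rw [klDivOn_eq_of_pos hL hrpos (hrL r hr), klDivOn_eq_of_pos hL hq rfl, EReal.coe_le_coe_iff]
      at hle
    have h0 : 0 ≤ (∑ ω ∈ A, p ω * Real.log (r ω / q ω)) / prob p A := by
      rw [← diff r hr hrpos]; linarith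
    have h1 : 0 ≤ ∑ ω ∈ A, p ω * Real.log (r ω / q ω) := by
      by_contra h
      exact absurd h0 (not_le.2 (div_neg_of_neg_of_pos (not_le.1 h) hpA))
    have hz := sum_mul_div_sub_one_eq_zero hq hprop (hmass r hr)
    -- The left terms are bounded by the right ones, which sum to zero, while optimality of `r`
    -- makes the left sum nonnegative. So each bound `ln x ≤ x - 1` is tight, which forces `x = r ω
    -- / q ω = 1`.
    have heq : ∀ ω ∈ A, p ω * Real.log (r ω / q ω) = p ω * (r ω / q ω - 1) :=
      (Finset.sum_eq_sum_iff_of_le (term r hrpos)).1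
        (le_antisymm (Finset.sum_le_sum (term r hrpos)) (hz ▸ h1))
    refine bayes_congr fun ω hω => ?_
    by_contra hne
    have h := Real.log_lt_sub_one_of_pos (div_pos (hrpos ω hω) (hq ω hω))
      (fun h => hne ((div_eq_one_iff_eq (hq ω hω).ne').1 h))
    exact h.ne (mul_left_cancel₀ (hp ω).ne' (heq ω hω))
  · rintro rfl
    refine ⟨⟨q, hqN, rfl⟩, ?_⟩
    rintro _ ⟨r, hr, rfl⟩
    rcases pos_or r hr with h | ⟨ω, hω, h0⟩
    · show klDivOn A (bayes p A) (bayes q A) ≤ klDivOn A (bayes p A) (bayes r A)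
      rw [klDivOn_eq_of_pos hL h (hrL r hr), klDivOn_eq_of_pos hL hq rfl, EReal.coe_le_coe_iff]
      have h1 : ∑ ω ∈ A, p ω * Real.log (r ω / q ω) ≤ 0 :=
        (Finset.sum_le_sum (term r h)).trans
          (sum_mul_div_sub_one_eq_zero hq hprop (hmass r hr)).le
      have := diff r hr h ▸ div_nonpos_of_nonpos_of_nonneg h1 hpA.le
      linarith
    · show klDivOn A (bayes p A) (bayes q A) ≤ klDivOn A (bayes p A) (bayes r A)
      rw [klDivOn_eq_top hp hω h0]
      exact le_top

end Divergence

/-! ### Upper probabilities and the posteriors they represent -/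

/-- `u` assigns to each subset of a cell of `Q` the upper probability of a rich set of plausible
priors with benchmark `p`. -/
structure IsUpper (p : Ω → ℝ) (Q : Finpartition (univ : Finset Ω)) (u : Finset Ω → ℝ) : Prop where
  simplex : p ∈ stdSimplex ℝ Ω
  full_support : ∀ ω, 0 < p ω
  empty : u ∅ = 0
  cell : ∀ P ∈ Q.parts, u P = prob p P
  mono : ∀ P ∈ Q.parts, ∀ D D', D ⊆ D' → D' ⊆ P → u D ≤ u D'
  ratio : ∀ P ∈ Q.parts, ∀ D D', D ⊆ D' → D' ⊆ P → u D' * prob p D ≤ u D * prob p D'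
  submod : ∀ P ∈ Q.parts, ∀ S T, S ⊆ P → T ⊆ P → u (S ∪ T) + u (S ∩ T) ≤ u S + u T
  strict : ∀ P ∈ Q.parts, ∀ D, D.Nonempty → D ⊂ P → prob p D < u D

/-- The maximal likelihood of `A` for the upper probability `u`. -/
def total (Q : Finpartition (univ : Finset Ω)) (u : Finset Ω → ℝ) (A : Finset Ω) : ℝ :=
  ∑ P ∈ Q.parts, u (A ∩ P)

/-- The part of the maximal likelihood of `A` that comes from the cells other than `P`. -/
def rest (Q : Finpartition (univ : Finset Ω)) (u : Finset Ω → ℝ) (P A : Finset Ω) : ℝ :=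
  ∑ P' ∈ Q.parts.erase P, u (A ∩ P')

/-- The posterior of each event `A` gives the cells of `Q` probabilities proportional to their
upper probabilities, and is proportional to `p` on the intersection of `A` with each cell. -/
def Represents (post : Finset Ω → Ω → ℝ) (p : Ω → ℝ) (Q : Finpartition (univ : Finset Ω))
    (u : Finset Ω → ℝ) : Prop :=
  ∀ A : Finset Ω, A.Nonempty → (∀ ω, ω ∉ A → post A ω = 0) ∧
    ∀ P ∈ Q.parts, ∀ ω ∈ A ∩ P,
      post A ω = u (A ∩ P) / total Q u A * (p ω / prob p (A ∩ P))

section Upper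

variable {p : Ω → ℝ} {Q : Finpartition (univ : Finset Ω)} {u : Finset Ω → ℝ}

theorem total_eq_add_rest {P : Finset Ω} (hP : P ∈ Q.parts) (A : Finset Ω) :
    total Q u A = u (A ∩ P) + rest Q u P A :=
  (Finset.add_sum_erase Q.parts (fun P => u (A ∩ P)) hP).symm

theorem rest_congr {P A B : Finset Ω} (hP : P ∈ Q.parts) (h : A \ P = B \ P) :
    rest Q u P A = rest Q u P B := by
  refine Finset.sum_congr rfl fun P' hP' => ?_
  have hd := Finset.disjoint_left.1
    (Q.disjoint (Finset.mem_of_mem_erase hP') hP (Finset.ne_of_mem_erase hP'))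
  congr 1
  ext x
  have := Finset.ext_iff.1 h x
  simp only [Finset.mem_sdiff] at this
  simp only [Finset.mem_inter]
  constructor
  · rintro ⟨h1, h2⟩; exact ⟨(this.1 ⟨h1, hd h2⟩).1, h2⟩
  · rintro ⟨h1, h2⟩; exact ⟨(this.2 ⟨h1, hd h2⟩).1, h2⟩

namespace IsUpper

variable (hu : IsUpper p Q u)
include hu

theorem nonneg_prior (ω : Ω) : 0 ≤ p ω := (hu.full_support ω).le

/-- The case `D' = P` of `ratio`, where `u P = prob p P` cancels. -/
theorem prob_le {P D : Finset Ω} (hP : P ∈ Q.parts) (hD : D ⊆ P) : prob p D ≤ u D := by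
  have h := hu.ratio P hP D P hD subset_rfl
  have hpos := prob_pos hu.full_support (Q.nonempty_of_mem_parts hP)
  rw [hu.cell P hP, mul_comm] at h
  exact le_of_mul_le_mul_right h hpos

theorem pos {P D : Finset Ω} (hP : P ∈ Q.parts) (hD : D ⊆ P) (hne : D.Nonempty) : 0 < u D :=
  (prob_pos hu.full_support hne).trans_le (hu.prob_le hP hD)

theorem nonneg {P D : Finset Ω} (hP : P ∈ Q.parts) (hD : D ⊆ P) : 0 ≤ u D :=
  (prob_nonneg hu.nonneg_prior D).trans (hu.prob_le hP hD)

theorem rest_nonneg (P A : Finset Ω) : 0 ≤ rest Q u P A :=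
  Finset.sum_nonneg fun _ hP' =>
    hu.nonneg (Finset.mem_of_mem_erase hP') Finset.inter_subset_right

theorem rest_pos {P A : Finset Ω} (h : (A \ P).Nonempty) : 0 < rest Q u P A := by
  obtain ⟨x, hx⟩ := h
  rw [Finset.mem_sdiff] at hx
  obtain ⟨P', hP', hxP'⟩ := Q.exists_mem (Finset.mem_univ x)
  refine Finset.sum_pos' (fun _ hP' =>
    hu.nonneg (Finset.mem_of_mem_erase hP') Finset.inter_subset_right) ⟨P', ?_, ?_⟩
  · refine Finset.mem_erase.2 ⟨?_, hP'⟩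
    rintro rfl
    exact hx.2 hxP'
  · exact hu.pos hP' Finset.inter_subset_right ⟨x, Finset.mem_inter.2 ⟨hx.1, hxP'⟩⟩

theorem total_pos {A : Finset Ω} (h : A.Nonempty) : 0 < total Q u A := by
  obtain ⟨x, hx⟩ := h
  obtain ⟨P, hP, hxP⟩ := Q.exists_mem (Finset.mem_univ x)
  rw [total_eq_add_rest hP]
  exact add_pos_of_pos_of_nonneg
    (hu.pos hP Finset.inter_subset_right ⟨x, Finset.mem_inter.2 ⟨hx, hxP⟩⟩) (hu.rest_nonneg P A)

theorem rest_eq_prob {P A : Finset Ω} (hP : P ∈ Q.parts) (hA : Pᶜ ⊆ A) :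
    rest Q u P A = prob p Pᶜ := by
  have h1 : rest Q u P A = ∑ P' ∈ Q.parts.erase P, prob p P' := by
    refine Finset.sum_congr rfl fun P' hP' => ?_
    have hd := Finset.disjoint_left.1
      (Q.disjoint (Finset.mem_of_mem_erase hP') hP (Finset.ne_of_mem_erase hP'))
    have hsub : P' ⊆ A := fun x hx => hA (Finset.mem_compl.2 (hd hx))
    rw [Finset.inter_eq_right.2 hsub, hu.cell P' (Finset.mem_of_mem_erase hP')]
  have h2 := prob_eq_sum_parts Q p univ
  simp only [Finset.univ_inter] at h2
  rw [← Finset.add_sum_erase Q.parts (fun P => prob p P) hP, prob_univ hu.simplex] at h2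
  rw [h1, prob_compl hu.simplex]
  linarith

end IsUpper

end Upper

namespace Represents

variable {post : Finset Ω → Ω → ℝ} {p : Ω → ℝ} {Q : Finpartition (univ : Finset Ω)}
  {u : Finset Ω → ℝ} {A P : Finset Ω}

theorem prob_cell (hr : Represents post p Q u) (hu : IsUpper p Q u) (hA : A.Nonempty)
    (hP : P ∈ Q.parts) : prob (post A) P = u (A ∩ P) / total Q u A := by
  rw [prob_inter_of_support (hr A hA).1]
  rcases (A ∩ P).eq_empty_or_nonempty with h | h
  · simp [h, hu.empty]
  · have hp := prob_pos hu.full_support h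
    have : prob (post A) (A ∩ P) =
        ∑ ω ∈ A ∩ P, u (A ∩ P) / total Q u A / prob p (A ∩ P) * p ω :=
      Finset.sum_congr rfl fun ω hω => by rw [(hr A hA).2 P hP ω hω]; ring
    rw [this, ← Finset.mul_sum]
    exact div_mul_cancel₀ _ hp.ne'

/-- The numerator depends on `A ∩ P` only and the denominator on `A \ P` only. If `A ⊆ P`, both
denominators vanish and both sides are `0` by the convention for division. -/
theorem odds_eq (hr : Represents post p Q u) (hu : IsUpper p Q u) (hA : A.Nonempty)
    (hP : P ∈ Q.parts) : odds post P A = u (A ∩ P) / rest Q u P A := by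
  have ht := hu.total_pos hA
  rw [odds, hr.prob_cell hu hA hP, one_sub_div ht.ne', div_div_div_cancel_right₀ ht.ne']
  congr 1
  rw [total_eq_add_rest hP]
  ring

theorem regularity (hr : Represents post p Q u) (hu : IsUpper p Q u)
    (hpost : ∀ A : Finset Ω, A.Nonempty → post A ∈ stdSimplex ℝ Ω) : Regularity post := by
  intro A hA
  refine ⟨fun ω hω => ?_, ?_⟩
  · obtain ⟨P, hP, hωP⟩ := Q.exists_mem (Finset.mem_univ ω)
    have hmem : ω ∈ A ∩ P := Finset.mem_inter.2 ⟨hω, hωP⟩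
    rw [(hr A hA).2 P hP ω hmem]
    exact mul_pos (div_pos (hu.pos hP Finset.inter_subset_right ⟨ω, hmem⟩) (hu.total_pos hA))
      (div_pos (hu.full_support ω) (prob_pos hu.full_support ⟨ω, hmem⟩))
  · have := prob_inter_of_support (hr A hA).1 univ
    rw [Finset.inter_univ] at this
    rw [← this, prob_univ (hpost A hA)]

end Represents

/-! ### Ideal events -/

/-- Conditioning on `E` removes the factor `a`. The hypothesis also applies to `A = E`, so `post E`
and the conditional of `post A` are both the normalization of `p` on `E`. -/
theorem isIdealEvent_of_proportional {post : Finset Ω → Ω → ℝ} {p : Ω → ℝ} {E : Finset Ω}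
    (hreg : Regularity post)
    (h : ∀ A : Finset Ω, A.Nonempty → E ⊆ A → ∃ a ≠ 0, ∀ ω ∈ E, post A ω = a * p ω) :
    IsIdealEvent post E := by
  intro A hA hEA ω hω
  obtain ⟨a, ha, hpa⟩ := h A hA hEA
  obtain ⟨b, hb, hpb⟩ := h E ⟨ω, hω⟩ subset_rfl
  have h1 := (hreg E ⟨ω, hω⟩).2
  rw [prob_congr hpb, prob_mul_left] at h1
  have h2 : prob p E ≠ 0 := by rintro h; simp [h] at h1
  rw [bayes, if_pos hω, prob_congr hpa, prob_mul_left, hpa ω hω, hpb ω hω,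
    mul_div_mul_left _ _ ha, eq_div_iff h2, mul_right_comm, h1, one_mul]

theorem IsIdealEvent.mul_eq_mul {post : Finset Ω → Ω → ℝ} {E A : Finset Ω}
    (h : IsIdealEvent post E) (hA : A.Nonempty) (hEA : E ⊆ A) {ω ω' : Ω} (hω : ω ∈ E)
    (hω' : ω' ∈ E) : post A ω * post E ω' = post A ω' * post E ω := by
  rw [h A hA hEA ω hω, h A hA hEA ω' hω', bayes, bayes, if_pos hω, if_pos hω']
  ring

theorem exists_eq_biUnion_parts_iff {Q : Finpartition (univ : Finset Ω)} {E : Finset Ω} :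
    (∃ S ⊆ Q.parts, E = S.biUnion id) ↔ ∀ P ∈ Q.parts, (E ∩ P).Nonempty → P ⊆ E := by
  constructor
  · rintro ⟨S, hS, rfl⟩ P hP ⟨x, hx⟩
    rw [Finset.mem_inter, Finset.mem_biUnion] at hx
    obtain ⟨⟨P', hP', hxP'⟩, hxP⟩ := hx
    rw [Q.eq_of_mem_parts hP (hS hP') hxP hxP']
    exact Finset.subset_biUnion_of_mem id hP'
  · intro h
    refine ⟨Q.parts.filter (· ⊆ E), Finset.filter_subset _ _, ?_⟩
    ext x
    simp only [Finset.mem_biUnion, Finset.mem_filter, id]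
    constructor
    · intro hx
      obtain ⟨P, hP, hxP⟩ := Q.exists_mem (Finset.mem_univ x)
      exact ⟨P, ⟨hP, h P hP ⟨x, Finset.mem_inter.2 ⟨hx, hxP⟩⟩⟩, hxP⟩
    · rintro ⟨P, ⟨_, hPE⟩, hx⟩
      exact hPE hx

/-! ### From a representation to the axioms -/

section Axioms

variable {post : Finset Ω → Ω → ℝ} {p : Ω → ℝ} {Q : Finpartition (univ : Finset Ω)}
  {u : Finset Ω → ℝ}

/-- Every cell that meets `E` lies in `A`, where `u P = prob p P`; the posterior on `E` is therefore
`p` divided by `total Q u A`. -/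
theorem Represents.isIdealEvent_of_union (hr : Represents post p Q u) (hu : IsUpper p Q u)
    (hreg : Regularity post) {E : Finset Ω}
    (hE : ∀ P ∈ Q.parts, (E ∩ P).Nonempty → P ⊆ E) : IsIdealEvent post E := by
  refine isIdealEvent_of_proportional (p := p) hreg fun A hA hEA => ?_
  refine ⟨1 / total Q u A, one_div_ne_zero (hu.total_pos hA).ne', fun ω hω => ?_⟩
  obtain ⟨P, hP, hωP⟩ := Q.exists_mem (Finset.mem_univ ω)
  have hPA : A ∩ P = P :=
    Finset.inter_eq_right.2 ((hE P hP ⟨ω, Finset.mem_inter.2 ⟨hω, hωP⟩⟩).trans hEA)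
  have hp := (prob_pos hu.full_support (Q.nonempty_of_mem_parts hP)).ne'
  rw [(hr A hA).2 P hP ω (Finset.mem_inter.2 ⟨hEA hω, hωP⟩), hPA, hu.cell P hP]
  field_simp

theorem Represents.isIdealEvent_of_subset (hr : Represents post p Q u) (hu : IsUpper p Q u)
    (hreg : Regularity post) {P D : Finset Ω} (hP : P ∈ Q.parts) (hD : D ⊆ P) :
    IsIdealEvent post D := by
  rcases D.eq_empty_or_nonempty with rfl | hne
  · exact fun A _ _ ω hω => by simp at hω
  refine isIdealEvent_of_proportional (p := p) hreg fun A hA hDA => ?_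
  have hDAP : D ⊆ A ∩ P := Finset.subset_inter hDA hD
  refine ⟨u (A ∩ P) / total Q u A / prob p (A ∩ P), ?_, fun ω hω => ?_⟩
  · exact (div_pos (div_pos (hu.pos hP Finset.inter_subset_right (hne.mono hDAP))
      (hu.total_pos hA)) (prob_pos hu.full_support (hne.mono hDAP))).ne'
  · rw [(hr A hA).2 P hP ω (hDAP hω)]
    ring

/-- Compare a state `x` of `E ∩ P` with a state `y` of `E \ P`, at `E` and at `E ∪ P`. Completing
`P` lowers the factor `u / p` of the cell of `x` from above `1` (by `strict`) to `1` and leaves that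
of `y` unchanged, so the odds of `x` against `y` change. -/
theorem Represents.not_isIdealEvent (hr : Represents post p Q u) (hu : IsUpper p Q u)
    {P E : Finset Ω} (hP : P ∈ Q.parts) (hne : (E ∩ P).Nonempty)
    (hnot : ¬ P ⊆ E) (hout : (E \ P).Nonempty) : ¬ IsIdealEvent post E := by
  intro hE
  obtain ⟨x, hx⟩ := hne
  obtain ⟨y, hy⟩ := hout
  rw [Finset.mem_inter] at hx
  rw [Finset.mem_sdiff] at hy
  obtain ⟨P', hP', hyP'⟩ := Q.exists_mem (Finset.mem_univ y)
  have hne : P' ≠ P := by rintro rfl; exact hy.2 hyP'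
  have hEn : E.Nonempty := ⟨x, hx.1⟩
  have hAn : (E ∪ P).Nonempty := ⟨x, Finset.mem_union_left _ hx.1⟩
  have key := hE.mul_eq_mul hAn Finset.subset_union_left hx.1 hy.1
  have e1 : (E ∪ P) ∩ P = P := Finset.inter_eq_right.2 Finset.subset_union_right
  have e2 : (E ∪ P) ∩ P' = E ∩ P' := by
    have hd : P ∩ P' = ∅ :=
      Finset.disjoint_iff_inter_eq_empty.1 (Q.disjoint hP hP' hne.symm)
    rw [Finset.union_inter_distrib_right, hd, Finset.union_empty]
  have hyE : y ∈ E ∩ P' := Finset.mem_inter.2 ⟨hy.1, hyP'⟩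
  have hxE : x ∈ E ∩ P := Finset.mem_inter.2 hx
  rw [(hr _ hAn).2 P hP x (by rw [e1]; exact hx.2), (hr _ hAn).2 P' hP' y (by rwa [e2]),
    (hr _ hEn).2 P hP x hxE, (hr _ hEn).2 P' hP' y hyE, e1, e2, hu.cell P hP] at key
  have h1 := hu.total_pos hAn
  have h2 := hu.total_pos hEn
  have h3 := hu.pos hP' Finset.inter_subset_right ⟨y, hyE⟩
  have h4 := prob_pos hu.full_support ⟨y, hyE⟩
  have h5 := prob_pos hu.full_support (Q.nonempty_of_mem_parts hP)
  have h6 := prob_pos hu.full_support ⟨x, hxE⟩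
  have h7 := hu.full_support x
  have h8 := hu.full_support y
  have h9 := hu.strict P hP (E ∩ P) ⟨x, hxE⟩
    ⟨Finset.inter_subset_right, fun h => hnot (h.trans Finset.inter_subset_left)⟩
  field_simp at key
  linarith

/-- If `E` splits a cell `P`, so does `Eᶜ`, and a state outside `P` lies in one of the two, which is
then not ideal. The hypothesis `hQ` supplies that state; it covers both the partition into
singletons and partitions without the cell `univ`. -/
theorem Represents.generates (hr : Represents post p Q u) (hu : IsUpper p Q u)
    (hreg : Regularity post)
    (hQ : ∀ P ∈ Q.parts, ∀ D : Finset Ω, D.Nonempty → D ⊂ P → ∃ x, x ∉ P) :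
    Generates post Q := by
  intro E
  rw [exists_eq_biUnion_parts_iff]
  constructor
  · rintro ⟨hE, hEc⟩ P hP hne
    by_contra hnot
    have hnec : (Eᶜ ∩ P).Nonempty := by
      obtain ⟨x, hx, hxE⟩ := Finset.not_subset.1 hnot
      exact ⟨x, Finset.mem_inter.2 ⟨Finset.mem_compl.2 hxE, hx⟩⟩
    have hnotc : ¬ P ⊆ Eᶜ := by
      intro h
      obtain ⟨x, hx⟩ := hne
      rw [Finset.mem_inter] at hx
      exact Finset.mem_compl.1 (h hx.2) hx.1
    obtain ⟨x, hx⟩ := hQ P hP (E ∩ P) hne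
      ⟨Finset.inter_subset_right, fun h => hnot (h.trans Finset.inter_subset_left)⟩
    by_cases hxE : x ∈ E
    · exact hr.not_isIdealEvent hu hP hne hnot ⟨x, Finset.mem_sdiff.2 ⟨hxE, hx⟩⟩ hE
    · exact hr.not_isIdealEvent hu hP hnec hnotc
        ⟨x, Finset.mem_sdiff.2 ⟨Finset.mem_compl.2 hxE, hx⟩⟩ hEc
  · intro h
    refine ⟨hr.isIdealEvent_of_union hu hreg h, hr.isIdealEvent_of_union hu hreg ?_⟩
    rintro P hP ⟨x, hx⟩ y hy
    rw [Finset.mem_inter, Finset.mem_compl] at hx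
    rw [Finset.mem_compl]
    exact fun hyE => hx.1 (h P hP ⟨y, Finset.mem_inter.2 ⟨hyE, hy⟩⟩ hx.2)

theorem Generates.iAlgebra (hQ : Generates post Q) : IAlgebra post := by
  intro E E' hE hE'
  rw [hQ, exists_eq_biUnion_parts_iff] at hE hE' ⊢
  rintro P hP ⟨x, hx⟩
  simp only [Finset.mem_inter] at hx
  exact Finset.subset_inter (hE P hP ⟨x, Finset.mem_inter.2 ⟨hx.1.1, hx.2⟩⟩)
    (hE' P hP ⟨x, Finset.mem_inter.2 ⟨hx.1.2, hx.2⟩⟩)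

theorem div_add_le_div_add {a b c : ℝ} (ha : 0 < a) (hab : a ≤ b) (hc : 0 ≤ c) :
    a / (a + c) ≤ b / (b + c) := by
  rw [div_le_div_iff₀ (by linarith) (by linarith)]
  nlinarith

/-- Removing states of `P` keeps `c = rest Q u P A`. All three probabilities have the form `t / (t +
c)`, with `t` equal to `u (A ∩ P)` before, `u ((A \ D) ∩ P)` after, and `u (A ∩ P)` scaled by a
ratio of `p`-masses under Bayesian conditioning. `mono` and `ratio` compare these values of `t`. -/
theorem Represents.betweenness (hr : Represents post p Q u) (hu : IsUpper p Q u)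
    {A P D : Finset Ω} (hA : A.Nonempty) (hP : P ∈ Q.parts) (hD : D ⊂ A ∩ P) :
    prob (post (A \ D)) P ≤ prob (post A) P ∧
      prob (bayes (post A) (A \ D)) P ≤ prob (post (A \ D)) P := by
  obtain ⟨x, hx, hxD⟩ := Finset.exists_of_ssubset hD
  have hDP : D ⊆ P := hD.1.trans Finset.inter_subset_right
  have hxA := Finset.mem_inter.1 hx
  have hB : (A \ D).Nonempty := ⟨x, Finset.mem_sdiff.2 ⟨hxA.1, hxD⟩⟩
  have hBP : ((A \ D) ∩ P).Nonempty :=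
    ⟨x, Finset.mem_inter.2 ⟨Finset.mem_sdiff.2 ⟨hxA.1, hxD⟩, hxA.2⟩⟩
  have hrest : rest Q u P (A \ D) = rest Q u P A := by
    refine rest_congr hP ?_
    ext y
    have : y ∈ D → y ∈ P := fun h => hDP h
    simp only [Finset.mem_sdiff]
    tauto
  have hsub : (A \ D) ∩ P ⊆ A ∩ P := Finset.inter_subset_inter Finset.sdiff_subset subset_rfl
  have hu1 := hu.pos hP Finset.inter_subset_right hBP
  have hu2 := hu.pos hP Finset.inter_subset_right ⟨x, hx⟩
  have hc := hu.rest_nonneg P A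
  refine ⟨?_, ?_⟩
  · rw [hr.prob_cell hu hA hP, hr.prob_cell hu hB hP, total_eq_add_rest hP, total_eq_add_rest hP,
      hrest]
    exact div_add_le_div_add hu1
      (hu.mono P hP _ _ hsub Finset.inter_subset_right) hc
  · have ht := hu.total_pos hA
    have hp1 := prob_pos hu.full_support hBP
    have hp2 := prob_pos hu.full_support ⟨x, hx⟩
    set X := (A \ D) ∩ P with hX
    have h1 : prob (post A) X = u (A ∩ P) * prob p X / prob p (A ∩ P) / total Q u A := by
      have : prob (post A) X = ∑ ω ∈ X, u (A ∩ P) / total Q u A / prob p (A ∩ P) * p ω :=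
        Finset.sum_congr rfl fun ω hω => by rw [(hr A hA).2 P hP ω (hsub hω)]; ring
      rw [this, ← Finset.mul_sum]
      unfold prob
      field_simp
    have h2 : prob (post A) ((A \ D) \ P) = rest Q u P A / total Q u A := by
      have e : (A \ D) \ P = A \ (A ∩ P) := by
        ext y
        have : y ∈ D → y ∈ P := fun h => hDP h
        simp only [Finset.mem_sdiff, Finset.mem_inter]
        tauto
      have h3 : prob (post A) A = 1 := by
        rw [prob_eq_sum_parts Q]
        have : ∀ P' ∈ Q.parts, prob (post A) (A ∩ P') = u (A ∩ P') / total Q u A :=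
          fun P' hP' => by
            rw [← prob_inter_of_support (hr A hA).1, hr.prob_cell hu hA hP']
        rw [Finset.sum_congr rfl this, ← Finset.sum_div]
        exact div_self ht.ne'
      rw [e, prob_sdiff Finset.inter_subset_left, h3, ← prob_inter_of_support (hr A hA).1,
        hr.prob_cell hu hA hP, one_sub_div ht.ne', total_eq_add_rest hP]
      congr 1
      ring
    have h3 : prob (post A) (A \ D) = prob (post A) X + prob (post A) ((A \ D) \ P) := by
      rw [hX, ← prob_union (Finset.disjoint_sdiff_inter _ _).symm, Finset.union_comm,
        Finset.sdiff_union_inter]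
    have h4 : prob (bayes (post A) (A \ D)) P = prob (post A) X / prob (post A) (A \ D) := by
      rw [prob_inter_of_support (A := A \ D) fun ω hω => by simp [bayes, hω], prob, prob,
        Finset.sum_div]
      exact Finset.sum_congr rfl fun ω hω => by simp [bayes, (Finset.mem_inter.1 hω).1]
    rw [h4, h3, h1, h2, hr.prob_cell hu hB hP, total_eq_add_rest hP (A \ D), hrest,
      ← add_div, div_div_div_cancel_right₀ ht.ne']
    refine div_add_le_div_add (by positivity) ?_ hc
    rw [div_le_iff₀ hp2]
    exact hu.ratio P hP _ _ hsub Finset.inter_subset_right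

/-- The four odds share a denominator, and the sets `(A \ D₁) ∩ P` and `(A \ D₂) ∩ P` have union `A
∩ P` because `D₁` and `D₂` are disjoint. -/
theorem Represents.submodularity (hr : Represents post p Q u) (hu : IsUpper p Q u)
    {A P D₁ D₂ : Finset Ω} (hP : P ∈ Q.parts) (hA : (A \ P).Nonempty) (h₁ : D₁ ⊆ P) (h₂ : D₂ ⊆ P)
    (hd : D₁ ∩ D₂ = ∅) :
    odds post P A + odds post P (A \ (D₁ ∪ D₂)) ≤ odds post P (A \ D₁) + odds post P (A \ D₂) := by
  have hc := hu.rest_pos hA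
  have key : ∀ D ⊆ P, odds post P (A \ D) = u ((A \ D) ∩ P) / rest Q u P A := by
    intro D hD
    have e : (A \ D) \ P = A \ P := by
      ext y
      have : y ∈ D → y ∈ P := fun h => hD h
      simp only [Finset.mem_sdiff]
      tauto
    rw [hr.odds_eq hu ((e ▸ hA).mono Finset.sdiff_subset) hP, rest_congr hP e]
  have h0 := key ∅ (Finset.empty_subset _)
  rw [Finset.sdiff_empty] at h0
  rw [h0, key _ (Finset.union_subset h₁ h₂), key _ h₁, key _ h₂, ← add_div, ← add_div]
  refine div_le_div_of_nonneg_right ?_ hc.le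
  have := hu.submod P hP ((A \ D₁) ∩ P) ((A \ D₂) ∩ P) Finset.inter_subset_right
    Finset.inter_subset_right
  rwa [← Finset.union_inter_distrib_right, ← Finset.sdiff_inter_distrib_right, hd,
    Finset.sdiff_empty, ← Finset.inter_inter_distrib_right, ← Finset.sdiff_union_distrib] at this

/-- The logarithm of the odds is a function of `A ∩ P` minus a function of `A \ P`; `D₁` affects
only the first and `D₂` only the second. -/
theorem Represents.log_modularity (hr : Represents post p Q u) (hu : IsUpper p Q u)
    {A P D₁ D₂ : Finset Ω} (hP : P ∈ Q.parts) (h₁ : D₁ ⊂ A ∩ P) (h₂ : D₂ ⊂ A ∩ Pᶜ) :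
    Real.log (odds post P A) + Real.log (odds post P (A \ (D₁ ∪ D₂))) =
      Real.log (odds post P (A \ D₁)) + Real.log (odds post P (A \ D₂)) := by
  obtain ⟨x, hx, hxD⟩ := Finset.exists_of_ssubset h₁
  obtain ⟨y, hy, hyD⟩ := Finset.exists_of_ssubset h₂
  simp only [Finset.mem_inter, Finset.mem_compl] at hx hy
  have i₁ : ∀ z ∈ D₁, z ∈ P := fun z hz => (Finset.mem_inter.1 (h₁.1 hz)).2
  have i₂ : ∀ z ∈ D₂, z ∉ P := fun z hz => Finset.mem_compl.1 (Finset.mem_inter.1 (h₂.1 hz)).2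
  have key : ∀ B : Finset Ω, x ∈ B → y ∈ B →
      Real.log (odds post P B) = Real.log (u (B ∩ P)) - Real.log (rest Q u P B) := by
    intro B hxB hyB
    rw [hr.odds_eq hu ⟨x, hxB⟩ hP, Real.log_div]
    · exact (hu.pos hP Finset.inter_subset_right ⟨x, Finset.mem_inter.2 ⟨hxB, hx.2⟩⟩).ne'
    · exact (hu.rest_pos ⟨y, Finset.mem_sdiff.2 ⟨hyB, hy.2⟩⟩).ne'
  have hxD₂ : x ∉ D₂ := fun h => i₂ x h hx.2
  have hyD₁ : y ∉ D₁ := fun h => hy.2 (i₁ y h)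
  rw [key A hx.1 hy.1, key (A \ (D₁ ∪ D₂)) (by simp [hx, hxD, hxD₂]) (by simp [hy, hyD, hyD₁]),
    key (A \ D₁) (by simp [hx, hxD]) (by simp [hy, hyD₁]),
    key (A \ D₂) (by simp [hx, hxD₂]) (by simp [hy, hyD])]
  have e1 : (A \ (D₁ ∪ D₂)) ∩ P = (A \ D₁) ∩ P := by
    ext z
    have := i₂ z
    simp only [Finset.mem_sdiff, Finset.mem_inter, Finset.mem_union]
    tauto
  have e2 : (A \ D₂) ∩ P = A ∩ P := by
    ext z
    have := i₂ z
    simp only [Finset.mem_sdiff, Finset.mem_inter]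
    tauto
  have e3 : rest Q u P (A \ (D₁ ∪ D₂)) = rest Q u P (A \ D₂) := by
    refine rest_congr hP ?_
    ext z
    have := i₁ z
    simp only [Finset.mem_sdiff, Finset.mem_union]
    tauto
  have e4 : rest Q u P (A \ D₁) = rest Q u P A := by
    refine rest_congr hP ?_
    ext z
    have := i₁ z
    simp only [Finset.mem_sdiff]
    tauto
  rw [e1, e2, e3, e4]
  ring

theorem Represents.satisfiesAxioms (hr : Represents post p Q u) (hu : IsUpper p Q u)
    (hpost : ∀ A : Finset Ω, A.Nonempty → post A ∈ stdSimplex ℝ Ω)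
    (hQ : ∀ P ∈ Q.parts, ∀ D : Finset Ω, D.Nonempty → D ⊂ P → ∃ x, x ∉ P) :
    SatisfiesAxioms post := by
  have hreg := hr.regularity hu hpost
  have hgen := hr.generates hu hreg hQ
  have hmem : ∀ P ∈ revealedPartition post, P ∈ Q.parts := fun P hP => by
    rw [← parts_eq_of_generating hgen] at hP
    exact hP
  exact
    { regularity := hreg
      algebra := hgen.iAlgebra
      betweenness := fun A hA P hP D hD => hr.betweenness hu hA (hmem P hP) hD
      submodularity := fun A P hP hA D₁ D₂ h₁ h₂ hd =>
        hr.submodularity hu (hmem P hP) hA h₁ h₂ hd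
      log_modularity := fun A P hP _ _ D₁ D₂ h₁ h₂ => hr.log_modularity hu (hmem P hP) h₁ h₂
      idealness := fun P hP D hD => hr.isIdealEvent_of_subset hu hreg (hmem P hP) hD.1 }

/-! ### The revealed upper probability and the prior -/

/-- At `Pᶜ ∪ D` the other cells are complete, so the odds of `P` are `u D / prob p Pᶜ`. -/
theorem Represents.revealedUpper_eq (hr : Represents post p Q u) (hu : IsUpper p Q u)
    (hpost : ∀ A : Finset Ω, A.Nonempty → post A ∈ stdSimplex ℝ Ω)
    {P D : Finset Ω} (hP : P ∈ Q.parts) (hPu : P ≠ univ) (hD : D ⊆ P) :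
    revealedUpper post P D = u D := by
  have hne : Pᶜ.Nonempty := by rwa [Finset.nonempty_iff_ne_empty, Ne, Finset.compl_eq_empty_iff]
  have huniv : (univ : Finset Ω).Nonempty := hne.mono (Finset.subset_univ _)
  have hA : (Pᶜ ∪ D).Nonempty := hne.mono Finset.subset_union_left
  have e1 : (Pᶜ ∪ D) ∩ P = D := by
    ext x
    have : x ∈ D → x ∈ P := fun h => hD h
    simp only [Finset.mem_inter, Finset.mem_union, Finset.mem_compl]
    tauto
  have hpc := prob_pos hu.full_support hne
  have ht := hu.total_pos hA
  have ht' := hu.total_pos huniv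
  have tot : ∀ A, Pᶜ ⊆ A → total Q u A = u (A ∩ P) + prob p Pᶜ := fun A h => by
    rw [total_eq_add_rest hP, hu.rest_eq_prob hP h]
  rw [tot _ Finset.subset_union_left, e1] at ht
  rw [tot _ (Finset.subset_univ _), Finset.univ_inter, hu.cell P hP] at ht'
  rw [revealedUpper, prob_compl (hpost _ hA), prob_compl (hpost _ huniv),
    hr.prob_cell hu hA hP, hr.prob_cell hu huniv hP, tot _ Finset.subset_union_left,
    tot _ (Finset.subset_univ _), e1, Finset.univ_inter, hu.cell P hP]
  have h1 : prob p P + prob p Pᶜ = 1 := by rw [prob_compl hu.simplex]; ring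
  rw [h1, div_one, one_sub_div ht.ne', add_sub_cancel_left, ← prob_compl hu.simplex]
  field_simp

theorem Represents.prior_eq (hr : Represents post p Q u) (hu : IsUpper p Q u) [Nonempty Ω] :
    p = post univ := by
  funext ω
  obtain ⟨P, hP, hωP⟩ := Q.exists_mem (Finset.mem_univ ω)
  have hpp := prob_pos hu.full_support (Q.nonempty_of_mem_parts hP)
  have ht : total Q u univ = 1 := by
    rw [total_eq_add_rest hP, hu.rest_eq_prob hP (Finset.subset_univ _), Finset.univ_inter,
      hu.cell P hP, prob_compl hu.simplex]
    ring
  rw [(hr univ Finset.univ_nonempty).2 P hP ω (by simpa using hωP), ht, Finset.univ_inter,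
    hu.cell P hP]
  field_simp

end Axioms

/-! ### Greedy priors -/

/-- States are sorted by `f`, with ties broken arbitrarily; hence only strict inequalities carry
over. -/
theorem exists_ranking {α : Type*} [LinearOrder α] (f : Ω → α) :
    ∃ σ : Ω ≃ Fin (Fintype.card Ω), ∀ x y, f x < f y → σ x < σ y := by
  let e := Fintype.equivFin Ω
  refine ⟨e.trans (Tuple.sort (f ∘ e.symm)).symm, fun x y h => ?_⟩
  by_contra hn
  have := Tuple.monotone_sort (f ∘ e.symm) (not_lt.1 hn)
  simp only [Function.comp, Equiv.trans_apply, Equiv.apply_symm_apply,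
    Equiv.symm_apply_apply] at this
  exact absurd h (not_lt.2 this)

/-- Each state receives the increment of `u` when it is added to the states of its cell that
precede it in the order given by `σ`. -/
def greedy (Q : Finpartition (univ : Finset Ω)) (u : Finset Ω → ℝ)
    (σ : Ω ≃ Fin (Fintype.card Ω)) (ω : Ω) : ℝ :=
  u {ω' ∈ Q.part ω | σ ω' ≤ σ ω} - u {ω' ∈ Q.part ω | σ ω' < σ ω}

/-- `I` consists of the first states of `P` in the order given by `σ`. -/
def IsInitial (σ : Ω ≃ Fin (Fintype.card Ω)) (P I : Finset Ω) : Prop :=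
  I ⊆ P ∧ ∀ x ∈ I, ∀ y ∈ P, σ y ≤ σ x → y ∈ I

namespace IsInitial

variable {σ : Ω ≃ Fin (Fintype.card Ω)} {P I : Finset Ω}

protected theorem refl (σ : Ω ≃ Fin (Fintype.card Ω)) (P : Finset Ω) : IsInitial σ P P :=
  ⟨subset_rfl, fun _ _ _ hy _ => hy⟩

theorem erase (h : IsInitial σ P I) {m : Ω} (hmax : ∀ x ∈ I, σ x ≤ σ m) :
    IsInitial σ P (I.erase m) := by
  refine ⟨(Finset.erase_subset _ _).trans h.1, fun x hx y hy hle => ?_⟩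
  rw [Finset.mem_erase] at hx ⊢
  refine ⟨?_, h.2 x hx.2 y hy hle⟩
  rintro rfl
  exact hx.1 (σ.injective (le_antisymm (hmax x hx.2) hle))

theorem filter_le (h : IsInitial σ P I) {m : Ω} (hm : m ∈ I) (hmax : ∀ x ∈ I, σ x ≤ σ m) :
    ({x ∈ P | σ x ≤ σ m} : Finset Ω) = I := by
  ext x
  rw [Finset.mem_filter]
  exact ⟨fun hx => h.2 m hm x hx.1 hx.2, fun hx => ⟨h.1 hx, hmax x hx⟩⟩

theorem filter_lt (h : IsInitial σ P I) {m : Ω} (hm : m ∈ I) (hmax : ∀ x ∈ I, σ x ≤ σ m) :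
    ({x ∈ P | σ x < σ m} : Finset Ω) = I.erase m := by
  ext x
  rw [Finset.mem_filter, Finset.mem_erase]
  refine ⟨fun hx => ⟨?_, h.2 m hm x hx.1 hx.2.le⟩, fun hx => ⟨h.1 hx.2, ?_⟩⟩
  · rintro rfl
    exact lt_irrefl _ hx.2
  · exact lt_of_le_of_ne (hmax x hx.2) fun h => hx.1 (σ.injective h)

end IsInitial

section Greedy

variable {p : Ω → ℝ} {Q : Finpartition (univ : Finset Ω)} {u : Finset Ω → ℝ}
  {σ : Ω ≃ Fin (Fintype.card Ω)} {P : Finset Ω}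

theorem greedy_of_mem (hP : P ∈ Q.parts) {ω : Ω} (hω : ω ∈ P) :
    greedy Q u σ ω = u {ω' ∈ P | σ ω' ≤ σ ω} - u {ω' ∈ P | σ ω' < σ ω} := by
  rw [greedy, Q.part_eq_of_mem hP hω]

/-- The increments telescope: the last state of `I` contributes `u I` minus `u` of what precedes it.
-/
theorem IsUpper.prob_greedy_of_isInitial (hu : IsUpper p Q u) (hP : P ∈ Q.parts) {I : Finset Ω}
    (hI : IsInitial σ P I) : prob (greedy Q u σ) I = u I := by
  induction I using Finset.strongInduction with
  | H I ih =>
    rcases I.eq_empty_or_nonempty with rfl | hne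
    · rw [prob_empty, hu.empty]
    · obtain ⟨m, hm, hmax⟩ := Finset.exists_max_image I σ hne
      have h := ih _ (Finset.erase_ssubset hm) (hI.erase hmax)
      have hg := greedy_of_mem (u := u) (σ := σ) hP (hI.1 hm)
      rw [hI.filter_le hm hmax, hI.filter_lt hm hmax] at hg
      unfold prob at h ⊢
      rw [← Finset.add_sum_erase I _ hm, h, hg]
      ring

/-- Diminishing increments: adding the last state `m` of `D` to all its predecessors in `P` raises
`u` by no more than adding it to `D.erase m`. -/
theorem IsUpper.prob_greedy_le (hu : IsUpper p Q u) (hP : P ∈ Q.parts) {D : Finset Ω}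
    (hD : D ⊆ P) : prob (greedy Q u σ) D ≤ u D := by
  induction D using Finset.strongInduction with
  | H D ih =>
    rcases D.eq_empty_or_nonempty with rfl | hne
    · rw [prob_empty, hu.empty]
    · obtain ⟨m, hm, hmax⟩ := Finset.exists_max_image D σ hne
      have h := ih _ (Finset.erase_ssubset hm) ((Finset.erase_subset _ _).trans hD)
      have hg := greedy_of_mem (u := u) (σ := σ) hP (hD hm)
      have hs := hu.submod P hP D {x ∈ P | σ x < σ m} hD (Finset.filter_subset _ _)
      have e1 : D ∪ ({x ∈ P | σ x < σ m} : Finset Ω) = ({x ∈ P | σ x ≤ σ m} : Finset Ω) := by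
        ext x
        simp only [Finset.mem_union, Finset.mem_filter]
        constructor
        · rintro (hx | hx)
          · exact ⟨hD hx, hmax x hx⟩
          · exact ⟨hx.1, hx.2.le⟩
        · rintro ⟨hx, hle⟩
          rcases hle.lt_or_eq with hlt | heq
          · exact Or.inr ⟨hx, hlt⟩
          · exact Or.inl (σ.injective heq ▸ hm)
      have e2 : D ∩ ({x ∈ P | σ x < σ m} : Finset Ω) = D.erase m := by
        ext x
        simp only [Finset.mem_inter, Finset.mem_filter, Finset.mem_erase]
        constructor
        · rintro ⟨hx, -, hlt⟩
          exact ⟨by rintro rfl; exact lt_irrefl _ hlt, hx⟩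
        · rintro ⟨hne, hx⟩
          exact ⟨hx, hD hx, lt_of_le_of_ne (hmax x hx) fun h => hne (σ.injective h)⟩
      rw [e1, e2] at hs
      unfold prob at h ⊢
      rw [← Finset.add_sum_erase D _ hm, hg]
      linarith

theorem IsUpper.greedy_nonneg (hu : IsUpper p Q u) (ω : Ω) : 0 ≤ greedy Q u σ ω := by
  obtain ⟨P, hP, hω⟩ := Q.exists_mem (Finset.mem_univ ω)
  rw [greedy_of_mem hP hω]
  refine sub_nonneg.2 (hu.mono P hP _ _ ?_ (Finset.filter_subset _ _))
  exact Finset.monotone_filter_right P fun x _ hx => le_of_lt hx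

/-! ### The base polytope -/

/-- The probability measures that agree with `p` on the cells of `Q` and are dominated by `u`
inside of each cell. -/
def basePolytope (p : Ω → ℝ) (Q : Finpartition (univ : Finset Ω)) (u : Finset Ω → ℝ) :
    Set (Ω → ℝ) :=
  {q | q ∈ stdSimplex ℝ Ω ∧
    ∀ P ∈ Q.parts, prob q P = prob p P ∧ ∀ D ⊆ P, prob q D ≤ u D}

theorem mem_stdSimplex_of_cells (hp : p ∈ stdSimplex ℝ Ω) {q : Ω → ℝ} (hq : ∀ ω, 0 ≤ q ω)
    (hcell : ∀ P ∈ Q.parts, prob q P = prob p P) : q ∈ stdSimplex ℝ Ω := by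
  refine ⟨hq, ?_⟩
  rw [← hp.2]
  have h1 := prob_eq_sum_parts Q q univ
  have h2 := prob_eq_sum_parts Q p univ
  simp only [Finset.univ_inter] at h1 h2
  rw [Finset.sum_congr rfl hcell, ← h2] at h1
  exact h1

theorem IsUpper.greedy_mem_basePolytope (hu : IsUpper p Q u) (σ : Ω ≃ Fin (Fintype.card Ω)) :
    greedy Q u σ ∈ basePolytope p Q u := by
  have hcell : ∀ P ∈ Q.parts, prob (greedy Q u σ) P = prob p P := fun P hP => by
    rw [hu.prob_greedy_of_isInitial hP (IsInitial.refl σ P), hu.cell P hP]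
  exact ⟨mem_stdSimplex_of_cells hu.simplex hu.greedy_nonneg hcell,
    fun P hP => ⟨hcell P hP, fun D hD => hu.prob_greedy_le hP hD⟩⟩

theorem IsUpper.prior_mem_basePolytope (hu : IsUpper p Q u) : p ∈ basePolytope p Q u :=
  ⟨hu.simplex, fun _ hP => ⟨rfl, fun _ hD => hu.prob_le hP hD⟩⟩

/-- Summation by parts as an induction that removes the last state `m`. The free bound `c` makes it
work: the smaller set is used with `c = f m`. -/
theorem IsInitial.mul_sum_le {I : Finset Ω} (hI : IsInitial σ P I) {f d : Ω → ℝ}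
    (hf : ∀ x y, σ x ≤ σ y → f y ≤ f x) (hd : ∀ J, IsInitial σ P J → 0 ≤ ∑ x ∈ J, d x) {c : ℝ}
    (hc : ∀ x ∈ I, c ≤ f x) : c * ∑ x ∈ I, d x ≤ ∑ x ∈ I, f x * d x := by
  induction I using Finset.strongInduction generalizing c with
  | H I ih =>
    rcases I.eq_empty_or_nonempty with rfl | hne
    · simp
    · obtain ⟨m, hm, hmax⟩ := Finset.exists_max_image I σ hne
      have h := ih _ (Finset.erase_ssubset hm) (hI.erase hmax) (c := f m)
        fun x hx => hf _ _ (hmax x (Finset.mem_of_mem_erase hx))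
      have h2 := mul_le_mul_of_nonneg_right (hc m hm) (hd I hI)
      rw [← Finset.add_sum_erase I _ hm] at h2 ⊢
      rw [← Finset.add_sum_erase I (fun x => f x * d x) hm]
      linarith

/-- A greedy prior for an order along which `f` decreases maximizes `f` over the base polytope. -/
theorem IsUpper.sum_mul_le_sum_mul_greedy (hu : IsUpper p Q u) (hP : P ∈ Q.parts) {q f : Ω → ℝ}
    (hqP : prob q P = prob p P) (hq : ∀ D ⊆ P, prob q D ≤ u D)
    (hf : ∀ x y, σ x ≤ σ y → f y ≤ f x) :
    ∑ ω ∈ P, f ω * q ω ≤ ∑ ω ∈ P, f ω * greedy Q u σ ω := by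
  have hsum : ∀ J, IsInitial σ P J → ∑ ω ∈ J, (greedy Q u σ ω - q ω) = u J - prob q J :=
    fun J hJ => by
      rw [Finset.sum_sub_distrib, ← hu.prob_greedy_of_isInitial hP hJ]
      rfl
  rcases P.eq_empty_or_nonempty with rfl | hne
  · simp
  obtain ⟨m, hm, hmax⟩ := Finset.exists_max_image P σ hne
  have h := (IsInitial.refl σ P).mul_sum_le (d := fun ω => greedy Q u σ ω - q ω) hf
    (fun J hJ => by rw [hsum J hJ]; exact sub_nonneg.2 (hq J hJ.1)) (c := f m)
    (fun x hx => hf _ _ (hmax x hx))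
  -- Both vectors have mass `prob p P` on `P`, so the lower bound is `f m * 0`.
  rw [hsum P (IsInitial.refl σ P), hu.cell P hP, hqP, sub_self, mul_zero] at h
  simp only [mul_sub, Finset.sum_sub_distrib] at h
  linarith

/-- The base polytope of a submodular function is the convex hull of the greedy vectors. -/
theorem IsUpper.restrict_mem_convexHull_greedy (hu : IsUpper p Q u) (hP : P ∈ Q.parts)
    {q : Ω → ℝ} (hqP : prob q P = prob p P) (hq : ∀ D ⊆ P, prob q D ≤ u D) :
    (fun ω : P => q ω) ∈ convexHull ℝ
      (Set.range fun (σ : Ω ≃ Fin (Fintype.card Ω)) (ω : P) => greedy Q u σ ω) := by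
  by_contra hnot
  -- A point outside this closed hull is strictly separated from it by a linear functional `F`, with
  -- coefficients `f`. The greedy vector for the order in which `f` decreases violates the
  -- separation.
  obtain ⟨F, c, hF, hc⟩ := geometric_hahn_banach_closed_point (convex_convexHull ℝ _)
    ((Set.finite_range _).isClosed_convexHull ℝ) hnot
  let f : Ω → ℝ := fun ω => if h : ω ∈ P then F (Pi.single ⟨ω, h⟩ 1) else 0
  have hFf : ∀ v : Ω → ℝ, F (fun ω : P => v ω) = ∑ ω ∈ P, f ω * v ω := by
    intro v
    have h1 := LinearMap.pi_apply_eq_sum_univ (F : (P → ℝ) →ₗ[ℝ] ℝ) (fun ω : P => v ω)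
    rw [← Finset.sum_coe_sort P]
    refine h1.trans (Finset.sum_congr rfl fun ω _ => ?_)
    have h2 : (fun j => if ω = j then (1 : ℝ) else 0) = Pi.single ω 1 := by
      funext j
      simp [Pi.single_apply, eq_comm]
    simp [f, h2, mul_comm]
  obtain ⟨σ, hσ⟩ := exists_ranking fun ω => -f ω
  have hle := hu.sum_mul_le_sum_mul_greedy (σ := σ) (f := f) hP hqP hq fun x y hxy => by
    by_contra hlt
    exact absurd (hσ y x (neg_lt_neg (not_le.1 hlt))) (not_lt.2 hxy)
  rw [← hFf, ← hFf] at hle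
  have := hF _ (subset_convexHull ℝ _ ⟨σ, rfl⟩)
  linarith

/-- The constraints of the polytope are linear and hold at greedy vectors, so they pass to the hull.
The other inclusion is `IsUpper.restrict_mem_convexHull_greedy`. -/
theorem greedySet_eq_basePolytope {post : Finset Ω → Ω → ℝ} (hu : IsUpper p Q u)
    (hQ : (Q.parts : Set (Finset Ω)) = revealedPartition post)
    (hrev : ∀ P ∈ Q.parts, ∀ D ⊆ P, revealedUpper post P D = u D) :
    greedySet post = basePolytope p Q u := by
  have hg : ∀ P ∈ Q.parts,
      (fun (σ : Ω ≃ Fin (Fintype.card Ω)) (ω : P) => greedyPrior post P σ ω) =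
        fun σ (ω : P) => greedy Q u σ ω := by
    intro P hP
    funext σ ω
    rw [greedyPrior, if_pos ω.2, greedy_of_mem hP ω.2, hrev P hP _ (Finset.filter_subset _ _),
      hrev P hP _ (Finset.filter_subset _ _)]
  ext q
  constructor
  · rintro ⟨hq, hhull⟩
    refine ⟨hq, fun P hP => ?_⟩
    have hmem := hhull P (hQ ▸ hP)
    rw [hg P hP] at hmem
    have hsum : ∀ (v : Ω → ℝ) (D : Finset Ω), D ⊆ P →
        (∑ ω : P, if (ω : Ω) ∈ D then v ω else 0) = prob v D := by
      intro v D hD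
      rw [Finset.sum_coe_sort P (fun ω => if ω ∈ D then v ω else 0), ← Finset.sum_filter,
        Finset.filter_mem_eq_inter, Finset.inter_eq_right.2 hD]
      rfl
    have hlin : ∀ D : Finset Ω, IsLinearMap ℝ
        fun v : P → ℝ => ∑ ω : P, if (ω : Ω) ∈ D then v ω else 0 := fun D =>
      { map_add := fun v w => by
          rw [← Finset.sum_add_distrib]
          exact Finset.sum_congr rfl fun ω _ => by by_cases h : (ω : Ω) ∈ D <;> simp [h]
        map_smul := fun a v => by
          rw [smul_eq_mul, Finset.mul_sum]
          exact Finset.sum_congr rfl fun ω _ => by by_cases h : (ω : Ω) ∈ D <;> simp [h] }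
    constructor
    · have h := convexHull_min (t := {v : P → ℝ |
        (∑ ω : P, if (ω : Ω) ∈ P then v ω else 0) = prob p P}) ?_
        (convex_hyperplane (hlin P) _) hmem
      · rw [← hsum q P subset_rfl]
        exact h
      · rintro _ ⟨σ, rfl⟩
        exact (hsum (greedy Q u σ) P subset_rfl).trans
          ((hu.greedy_mem_basePolytope σ).2 P hP).1
    · intro D hD
      have h := convexHull_min (t := {v : P → ℝ |
        (∑ ω : P, if (ω : Ω) ∈ D then v ω else 0) ≤ u D}) ?_
        (convex_halfSpace_le (hlin D) _) hmem
      · rw [← hsum q D hD]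
        exact h
      · rintro _ ⟨σ, rfl⟩
        exact (hsum (greedy Q u σ) D hD).le.trans (hu.prob_greedy_le hP hD)
  · rintro ⟨hq, hbase⟩
    refine ⟨hq, fun P hP => ?_⟩
    have hP' : P ∈ Q.parts := by
      rw [← hQ] at hP
      exact hP
    rw [hg P hP']
    exact hu.restrict_mem_convexHull_greedy hP' (hbase P hP').1 (hbase P hP').2

end Greedy

/-! ### Updating with an upper probability -/

section Updating

variable {p : Ω → ℝ} {Q : Finpartition (univ : Finset Ω)} {u : Finset Ω → ℝ} {N : Set (Ω → ℝ)}
  {A : Finset Ω}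

/-- Since `s` attains the bounds of all cells at once, the maximal likelihood is their sum, and a
sum of bounds is attained only if each one is. -/
theorem prob_inter_eq_of_mem_maxLik
    (hle : ∀ q ∈ N, ∀ P ∈ Q.parts, ∀ D ⊆ P, prob q D ≤ u D)
    {s : Ω → ℝ} (hs : s ∈ N) (hsA : ∀ P ∈ Q.parts, prob s (A ∩ P) = u (A ∩ P))
    {q : Ω → ℝ} (hq : q ∈ maxLik N A) : ∀ P ∈ Q.parts, prob q (A ∩ P) = u (A ∩ P) := by
  have h := hq.2 s hs
  rw [prob_eq_sum_parts Q s, prob_eq_sum_parts Q q, Finset.sum_congr rfl hsA] at h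
  have hle' : ∀ P ∈ Q.parts, prob q (A ∩ P) ≤ u (A ∩ P) := fun P hP =>
    hle q hq.1 P hP _ Finset.inter_subset_right
  exact (Finset.sum_eq_sum_iff_of_le hle').1 (le_antisymm (Finset.sum_le_sum hle') h)

theorem mem_maxLik_of_prob_inter_eq
    (hle : ∀ q ∈ N, ∀ P ∈ Q.parts, ∀ D ⊆ P, prob q D ≤ u D)
    {q : Ω → ℝ} (hq : q ∈ N) (hqA : ∀ P ∈ Q.parts, prob q (A ∩ P) = u (A ∩ P)) :
    q ∈ maxLik N A := by
  refine ⟨hq, fun r hr => ?_⟩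
  rw [prob_eq_sum_parts Q q, prob_eq_sum_parts Q r, Finset.sum_congr rfl hqA]
  exact Finset.sum_le_sum fun P hP => hle r hr P hP _ Finset.inter_subset_right

theorem IsUpper.prob_inter_eq_of_proportional (hu : IsUpper p Q u) {q : Ω → ℝ} {P : Finset Ω}
    (hq : ∀ ω ∈ A ∩ P, q ω = u (A ∩ P) / prob p (A ∩ P) * p ω) :
    prob q (A ∩ P) = u (A ∩ P) := by
  rw [prob_congr hq, prob_mul_left]
  rcases (A ∩ P).eq_empty_or_nonempty with h | h
  · rw [h, prob_empty, mul_zero, hu.empty]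
  · exact div_mul_cancel₀ _ (prob_pos hu.full_support h).ne'

/-- Serves both directions: `N` may be a rich set with its own upper probability or the base
polytope of a given `u`. -/
theorem IsUpper.klArgmin_eq (hu : IsUpper p Q u) (hN : N ⊆ stdSimplex ℝ Ω)
    (hle : ∀ q ∈ N, ∀ P ∈ Q.parts, ∀ D ⊆ P, prob q D ≤ u D) (hA : A.Nonempty)
    {q : Ω → ℝ} (hqN : q ∈ N)
    (hq : ∀ P ∈ Q.parts, ∀ ω ∈ A ∩ P, q ω = u (A ∩ P) / prob p (A ∩ P) * p ω) :
    klArgmin p N A = {bayes q A} := by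
  have hqA := fun P hP => hu.prob_inter_eq_of_proportional (hq P hP)
  refine klArgmin_eq_singleton (Q := Q) hu.full_support hA hN
    (mem_maxLik_of_prob_inter_eq hle hqN hqA) ?_ ?_ ?_
  · intro ω hω
    obtain ⟨P, hP, hωP⟩ := Q.exists_mem (Finset.mem_univ ω)
    have hmem := Finset.mem_inter.2 ⟨hω, hωP⟩
    rw [hq P hP ω hmem]
    exact mul_pos (div_pos (hu.pos hP Finset.inter_subset_right ⟨ω, hmem⟩)
      (prob_pos hu.full_support ⟨ω, hmem⟩)) (hu.full_support ω)
  · intro P hP ω hω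
    rw [hqA P hP, hq P hP ω hω]
  · intro r hr P hP
    rw [hqA P hP, prob_inter_eq_of_mem_maxLik hle hqN hqA hr P hP]

theorem IsUpper.bayes_apply (hu : IsUpper p Q u) {q : Ω → ℝ}
    (hq : ∀ P ∈ Q.parts, ∀ ω ∈ A ∩ P, q ω = u (A ∩ P) / prob p (A ∩ P) * p ω)
    {P : Finset Ω} (hP : P ∈ Q.parts) {ω : Ω} (hω : ω ∈ A ∩ P) :
    bayes q A ω = u (A ∩ P) / total Q u A * (p ω / prob p (A ∩ P)) := by
  have h : prob q A = total Q u A := by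
    rw [prob_eq_sum_parts Q, total]
    exact Finset.sum_congr rfl fun P hP => hu.prob_inter_eq_of_proportional (hq P hP)
  rw [bayes, if_pos (Finset.mem_inter.1 hω).1, h, hq P hP ω hω]
  ring

end Updating

/-! ### Richness of the base polytope -/

section BasePolytope

variable {p : Ω → ℝ} {Q : Finpartition (univ : Finset Ω)} {u : Finset Ω → ℝ}

theorem continuous_prob (D : Finset Ω) : Continuous fun q : Ω → ℝ => prob q D :=
  continuous_finsetSum _ fun ω _ => continuous_apply ω

theorem prob_add_smul (a b : ℝ) (q r : Ω → ℝ) (D : Finset Ω) :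
    prob (a • q + b • r) D = a * prob q D + b * prob r D := by
  simp [prob, Finset.sum_add_distrib, Finset.mul_sum]

theorem isClosed_basePolytope : IsClosed (basePolytope p Q u) := by
  simp only [basePolytope, Set.ofPred_and, Set.ofPred_forall]
  refine (isClosed_stdSimplex ℝ Ω).inter (isClosed_iInter fun P => isClosed_iInter fun _ =>
    (isClosed_eq (continuous_prob P) continuous_const).inter
      (isClosed_iInter fun D => isClosed_iInter fun _ =>
        isClosed_le (continuous_prob D) continuous_const))

theorem convex_basePolytope : Convex ℝ (basePolytope p Q u) := by
  intro q hq r hr a b ha hb hab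
  refine ⟨convex_stdSimplex ℝ Ω hq.1 hr.1 ha hb hab, fun P hP => ⟨?_, fun D hD => ?_⟩⟩
  · rw [prob_add_smul, (hq.2 P hP).1, (hr.2 P hP).1, ← add_mul, hab, one_mul]
  · rw [prob_add_smul, ← one_mul (u D), ← hab, add_mul]
    exact add_le_add (mul_le_mul_of_nonneg_left ((hq.2 P hP).2 D hD) ha)
      (mul_le_mul_of_nonneg_left ((hr.2 P hP).2 D hD) hb)

theorem exists_ranking_isInitial (S : Finset Ω) :
    ∃ σ : Ω ≃ Fin (Fintype.card Ω), ∀ P : Finset Ω, IsInitial σ P (S ∩ P) := by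
  obtain ⟨σ, hσ⟩ := exists_ranking fun ω => if ω ∈ S then (0 : ℕ) else 1
  refine ⟨σ, fun P => ⟨Finset.inter_subset_right, fun x hx y hy hle => ?_⟩⟩
  rw [Finset.mem_inter] at hx ⊢
  refine ⟨?_, hy⟩
  by_contra hyS
  exact absurd (hσ x y (by simp [hx.1, hyS])) (not_lt.2 hle)

theorem IsUpper.exists_mem_basePolytope_prob_inter_eq (hu : IsUpper p Q u) (S : Finset Ω) :
    ∃ g ∈ basePolytope p Q u, ∀ P ∈ Q.parts, prob g (S ∩ P) = u (S ∩ P) := by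
  obtain ⟨σ, hσ⟩ := exists_ranking_isInitial S
  exact ⟨greedy Q u σ, hu.greedy_mem_basePolytope σ,
    fun P hP => hu.prob_greedy_of_isInitial hP (hσ P)⟩

theorem IsUpper.exists_mem_basePolytope_chain (hu : IsUpper p Q u) {P : Finset Ω}
    (hP : P ∈ Q.parts) {m : ℕ} {D : Fin m → Finset Ω} (hD : Monotone D) (hDP : ∀ i, D i ⊆ P) :
    ∃ g ∈ basePolytope p Q u, ∀ i, prob g (D i) = u (D i) := by
  -- States are ranked by the number of members of the chain that omit them, which makes every `D i`
  -- initial.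
  obtain ⟨σ, hσ⟩ := exists_ranking fun ω => #{i | ω ∉ D i}
  refine ⟨greedy Q u σ, hu.greedy_mem_basePolytope σ, fun i =>
    hu.prob_greedy_of_isInitial hP ⟨hDP i, fun x hx y _ hle => ?_⟩⟩
  by_contra hy
  refine absurd (hσ x y (Finset.card_lt_card ⟨fun j hj => ?_, fun h => ?_⟩)) (not_lt.2 hle)
  · simp only [Finset.mem_filter, Finset.mem_univ, true_and] at hj ⊢
    intro hyj
    rcases le_total i j with hij | hij
    · exact hj (hD hij hx)
    · exact hy (hD hij hyj)
  · have := h (Finset.mem_filter.2 ⟨Finset.mem_univ i, hy⟩)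
    exact (Finset.mem_filter.1 this).2 hx

/-- Some measure in the base polytope attains the upper probabilities of the sets `A ∩ P` and is
proportional to `p` on them. -/
theorem IsUpper.exists_mem_basePolytope_proportional (hu : IsUpper p Q u) (A : Finset Ω) :
    ∃ q ∈ basePolytope p Q u,
      ∀ P ∈ Q.parts, ∀ ω ∈ A ∩ P, q ω = u (A ∩ P) / prob p (A ∩ P) * p ω := by
  obtain ⟨g, hg, hgA⟩ := hu.exists_mem_basePolytope_prob_inter_eq A
  -- Start from `g`, greedy with the states of `A` first, and redistribute its mass on each `A ∩ P`
  -- in proportion to `p`.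
  let q : Ω → ℝ := fun ω =>
    if ω ∈ A then u (A ∩ Q.part ω) / prob p (A ∩ Q.part ω) * p ω else g ω
  have hqA : ∀ P ∈ Q.parts, ∀ ω ∈ A ∩ P, q ω = u (A ∩ P) / prob p (A ∩ P) * p ω := by
    intro P hP ω hω
    rw [Finset.mem_inter] at hω
    simp only [q, if_pos hω.1, Q.part_eq_of_mem hP hω.2]
  have hnonneg : ∀ ω, 0 ≤ q ω := by
    intro ω
    by_cases hω : ω ∈ A
    · obtain ⟨P, hP, hωP⟩ := Q.exists_mem (Finset.mem_univ ω)
      rw [hqA P hP ω (Finset.mem_inter.2 ⟨hω, hωP⟩)]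
      exact mul_nonneg (div_nonneg (hu.nonneg hP Finset.inter_subset_right)
        (prob_nonneg hu.nonneg_prior _)) (hu.nonneg_prior ω)
    · simp only [q, if_neg hω]
      exact hg.1.1 ω
  have split : ∀ P ∈ Q.parts, ∀ D ⊆ P, prob q D =
      u (A ∩ P) / prob p (A ∩ P) * prob p (A ∩ D) + (prob g (D ∪ A ∩ P) - u (A ∩ P)) := by
    intro P hP D hD
    have hd : Disjoint (A ∩ D) (D \ A) := Finset.disjoint_left.2 fun x hx hx' =>
      (Finset.mem_sdiff.1 hx').2 (Finset.mem_inter.1 hx).1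
    have e1 : D = A ∩ D ∪ D \ A := by
      ext x
      simp only [Finset.mem_union, Finset.mem_inter, Finset.mem_sdiff]
      tauto
    have e2 : D \ A = (D ∪ A ∩ P) \ (A ∩ P) := by
      ext x
      have : x ∈ D → x ∈ P := fun h => hD h
      simp only [Finset.mem_union, Finset.mem_inter, Finset.mem_sdiff]
      tauto
    have h1 : prob q (A ∩ D) = u (A ∩ P) / prob p (A ∩ P) * prob p (A ∩ D) := by
      rw [← prob_mul_left]
      exact prob_congr fun ω hω => hqA P hP ω (Finset.inter_subset_inter subset_rfl hD hω)
    have h2 : prob q (D \ A) = prob g (D \ A) :=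
      prob_congr fun ω hω => if_neg (Finset.mem_sdiff.1 hω).2
    conv_lhs => rw [e1]
    rw [prob_union hd, h1, h2, e2, prob_sdiff Finset.subset_union_right, hgA P hP]
  have hcell : ∀ P ∈ Q.parts, prob q P = prob p P := by
    intro P hP
    have h := hu.prob_inter_eq_of_proportional (hqA P hP)
    rw [prob_congr (hqA P hP), prob_mul_left] at h
    rw [split P hP P subset_rfl, h, Finset.union_eq_left.2 Finset.inter_subset_right,
      (hg.2 P hP).1]
    ring
  refine ⟨q, ⟨mem_stdSimplex_of_cells hu.simplex hnonneg hcell, fun P hP => ⟨hcell P hP, ?_⟩⟩, hqA⟩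
  intro D hD
  have hAD : A ∩ D ⊆ A ∩ P := Finset.inter_subset_inter subset_rfl hD
  -- The two summands of `split` are bounded separately: the first by `u (A ∩ D)` through `ratio`,
  -- the second by `u D - u (A ∩ D)` through domination of `g` on `D ∪ A ∩ P` and submodularity for
  -- `D` and `A ∩ P`.
  have h1 : u (A ∩ P) / prob p (A ∩ P) * prob p (A ∩ D) ≤ u (A ∩ D) := by
    rcases (A ∩ P).eq_empty_or_nonempty with h | h
    · rw [h] at hAD
      rw [Finset.subset_empty.1 hAD, prob_empty, mul_zero, hu.empty]
    · rw [div_mul_eq_mul_div, div_le_iff₀ (prob_pos hu.full_support h)]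
      exact hu.ratio P hP _ _ hAD Finset.inter_subset_right
  have h2 := (hg.2 P hP).2 (D ∪ A ∩ P) (Finset.union_subset hD Finset.inter_subset_right)
  have h3 := hu.submod P hP D (A ∩ P) hD Finset.inter_subset_right
  have e : D ∩ (A ∩ P) = A ∩ D := by
    ext x
    have : x ∈ D → x ∈ P := fun h => hD h
    simp only [Finset.mem_inter]
    tauto
  rw [e] at h3
  rw [split P hP D hD]
  linarith

/-- Beyond membership in the simplex, each constraint involves a single cell, so cells can be
recombined freely. -/
theorem basePolytope_glue {P : Finset Ω} (hp : p ∈ stdSimplex ℝ Ω) (hP : P ∈ Q.parts)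
    {q r : Ω → ℝ} (hq : q ∈ basePolytope p Q u) (hr : r ∈ basePolytope p Q u) :
    (fun ω => if ω ∈ P then q ω else r ω) ∈ basePolytope p Q u := by
  have key : ∀ P' ∈ Q.parts, ∀ D ⊆ P', prob (fun ω => if ω ∈ P then q ω else r ω) D =
      if P' = P then prob q D else prob r D := by
    intro P' hP' D hD
    split_ifs with h
    · subst h
      exact prob_congr fun ω hω => if_pos (hD hω)
    · exact prob_congr fun ω hω =>
        if_neg (Finset.disjoint_left.1 (Q.disjoint hP' hP h) (hD hω))
  have hcell : ∀ P' ∈ Q.parts,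
      prob (fun ω => if ω ∈ P then q ω else r ω) P' = prob p P' := by
    intro P' hP'
    rw [key P' hP' P' subset_rfl]
    split_ifs
    · exact (hq.2 P' hP').1
    · exact (hr.2 P' hP').1
  refine ⟨mem_stdSimplex_of_cells hp (fun ω => ?_) hcell, fun P' hP' =>
    ⟨hcell P' hP', fun D hD => ?_⟩⟩
  · show 0 ≤ if ω ∈ P then q ω else r ω
    split_ifs
    · exact hq.1.1 ω
    · exact hr.1.1 ω
  · rw [key P' hP' D hD]
    split_ifs
    · exact (hq.2 P' hP').2 D hD
    · exact (hr.2 P' hP').2 D hD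

/-- A measure that attains `u D` lies above `p` by `strict`. One that attains `u (P \ D)` lies below
`p` on `D`, since the mass of `P` is fixed. -/
theorem IsUpper.exists_non_extreme (hu : IsUpper p Q u) {P D : Finset Ω} (hP : P ∈ Q.parts)
    (hne : D.Nonempty) (hD : D ⊂ P) :
    ∃ q ∈ basePolytope p Q u, ∃ r ∈ basePolytope p Q u,
      prob q D < prob p D ∧ prob p D < prob r D := by
  have hne' : (P \ D).Nonempty := Finset.sdiff_nonempty.2 hD.2
  have hss : P \ D ⊂ P := by
    refine ⟨Finset.sdiff_subset, fun h => ?_⟩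
    obtain ⟨x, hx⟩ := hne
    exact (Finset.mem_sdiff.1 (h (hD.1 hx))).2 hx
  obtain ⟨q, hq, hqD⟩ := hu.exists_mem_basePolytope_prob_inter_eq (P \ D)
  obtain ⟨r, hr, hrD⟩ := hu.exists_mem_basePolytope_prob_inter_eq D
  refine ⟨q, hq, r, hr, ?_, ?_⟩
  · have h1 := hqD P hP
    rw [Finset.inter_eq_left.2 hss.1, prob_sdiff hD.1, (hq.2 P hP).1] at h1
    have h2 := hu.strict P hP _ hne' hss
    rw [prob_sdiff hD.1] at h2
    linarith
  · have h1 := hrD P hP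
    rw [Finset.inter_eq_left.2 hD.1] at h1
    rw [h1]
    exact hu.strict P hP D hne hD

theorem IsUpper.isConsistent_basePolytope (hu : IsUpper p Q u) :
    IsConsistent p Q (basePolytope p Q u) where
  prior_mem := hu.simplex
  full_support := hu.full_support
  subset_simplex := fun _ hq => hq.1
  closed := isClosed_basePolytope
  convex := convex_basePolytope
  benchmark_mem := hu.prior_mem_basePolytope
  agree := fun _ hq P hP => (hq.2 P hP).1
  ambiguous := fun P hP D hne hD => by
    obtain ⟨q, hq, -, -, h, -⟩ := hu.exists_non_extreme hP hne hD
    exact ⟨q, hq, h.ne⟩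

theorem IsUpper.isRich_basePolytope (hu : IsUpper p Q u) : IsRich p Q (basePolytope p Q u) where
  non_extreme := fun _ hP _ hne hD => hu.exists_non_extreme hP hne hD
  prior_coherent := fun A _ => by
    obtain ⟨q, hq, hqA⟩ := hu.exists_mem_basePolytope_proportional A
    refine ⟨q, mem_maxLik_of_prob_inter_eq (fun q hq P hP => (hq.2 P hP).2) hq
      fun P hP => hu.prob_inter_eq_of_proportional (hqA P hP), fun P hP ω hω ω' hω' => ?_⟩
    have h1 := hu.pos hP Finset.inter_subset_right ⟨ω, hω⟩
    have h2 := prob_pos hu.full_support ⟨ω, hω⟩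
    rw [hqA P hP ω hω, hqA P hP ω' hω', mul_div_mul_left _ _ (div_pos h1 h2).ne']
  chain_coherent := fun P hP m D hD hDP => by
    obtain ⟨g, hg, hgD⟩ := hu.exists_mem_basePolytope_chain hP hD hDP
    refine ⟨g, hg, fun i r hr => ?_⟩
    rw [hgD i]
    exact (hr.2 P hP).2 _ (hDP i)
  rectangular := fun q hq r hr P hP =>
    ⟨_, basePolytope_glue hu.simplex hP hq hr, _, basePolytope_glue hu.simplex hP hr hq,
      fun _ hω => if_pos hω, fun _ hω => if_neg (Finset.mem_compl.1 hω),
      fun _ hω => if_pos hω, fun _ hω => if_neg (Finset.mem_compl.1 hω)⟩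

theorem IsUpper.isRichRML_basePolytope (hu : IsUpper p Q u) {post : Finset Ω → Ω → ℝ}
    (hr : Represents post p Q u) : IsRichRML post p Q (basePolytope p Q u) := by
  refine ⟨⟨hu.isConsistent_basePolytope, fun A hA => ?_⟩, hu.isRich_basePolytope⟩
  obtain ⟨q, hq, hqA⟩ := hu.exists_mem_basePolytope_proportional A
  rw [hu.klArgmin_eq (fun _ h => h.1) (fun q hq P hP => (hq.2 P hP).2) hA hq hqA,
    Set.singleton_eq_singleton_iff]
  funext ω
  by_cases hω : ω ∈ A
  · obtain ⟨P, hP, hωP⟩ := Q.exists_mem (Finset.mem_univ ω)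
    have hmem := Finset.mem_inter.2 ⟨hω, hωP⟩
    rw [hu.bayes_apply hqA hP hmem, (hr A hA).2 P hP ω hmem]
  · rw [bayes, if_neg hω, (hr A hA).1 ω hω]

end BasePolytope

/-! ### Upper probabilities of rich sets of priors -/

/-- The upper probability of `D` over `N`. -/
noncomputable def upperProb (N : Set (Ω → ℝ)) (D : Finset Ω) : ℝ :=
  sSup ((fun q => prob q D) '' N)

section Rich

variable {p : Ω → ℝ} {Q : Finpartition (univ : Finset Ω)} {N : Set (Ω → ℝ)}

theorem upperProb_eq {q : Ω → ℝ} {D : Finset Ω} (hq : q ∈ N) (h : ∀ r ∈ N, prob r D ≤ prob q D) :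
    upperProb N D = prob q D := by
  refine IsGreatest.csSup_eq ⟨⟨q, hq, rfl⟩, ?_⟩
  rintro _ ⟨r, hr, rfl⟩
  exact h r hr

theorem IsRich.exists_chain (hrich : IsRich p Q N) {P : Finset Ω} (hP : P ∈ Q.parts) {m : ℕ}
    {D : Fin m → Finset Ω} (hD : Monotone D) (hDP : ∀ i, D i ⊆ P) :
    ∃ q ∈ N, ∀ i, prob q (D i) = upperProb N (D i) := by
  obtain ⟨q, hq, h⟩ := hrich.chain_coherent P hP m D hD hDP
  exact ⟨q, hq, fun i => (upperProb_eq hq (h i)).symm⟩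

/-- A chain of length one: the supremum is attained, so `sSup` takes no default value here. -/
theorem IsRich.exists_prob_eq_upperProb (hrich : IsRich p Q N) {P D : Finset Ω} (hP : P ∈ Q.parts)
    (hD : D ⊆ P) :
    ∃ q ∈ N, prob q D = upperProb N D ∧ ∀ r ∈ N, prob r D ≤ upperProb N D := by
  obtain ⟨q, hq, h⟩ := hrich.chain_coherent P hP 1 (fun _ => D) monotone_const fun _ => hD
  have := upperProb_eq hq (h 0)
  exact ⟨q, hq, this.symm, fun r hr => (h 0 r hr).trans this.ge⟩

theorem IsRich.prob_le_upperProb (hrich : IsRich p Q N) :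
    ∀ q ∈ N, ∀ P ∈ Q.parts, ∀ D ⊆ P, prob q D ≤ upperProb N D := by
  intro q hq P hP D hD
  obtain ⟨-, -, -, h⟩ := hrich.exists_prob_eq_upperProb hP hD
  exact h q hq

theorem IsRich.exists_glue (hrich : IsRich p Q N) (hne : N.Nonempty) (r : Finset Ω → Ω → ℝ)
    (hr : ∀ P ∈ Q.parts, r P ∈ N) : ∃ s ∈ N, ∀ P ∈ Q.parts, ∀ ω ∈ P, s ω = r P ω := by
  suffices H : ∀ S ⊆ Q.parts, ∃ s ∈ N, ∀ P ∈ S, ∀ ω ∈ P, s ω = r P ω from H _ subset_rfl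
  intro S
  induction S using Finset.induction_on with
  | empty =>
    obtain ⟨s, hs⟩ := hne
    exact fun _ => ⟨s, hs, by simp⟩
  | insert P S hPS ih =>
    intro hS
    have hP : P ∈ Q.parts := hS (Finset.mem_insert_self P S)
    obtain ⟨s, hs, hsS⟩ := ih ((Finset.subset_insert P S).trans hS)
    obtain ⟨t, ht, -, -, h1, h2, -, -⟩ := hrich.rectangular (r P) (hr P hP) s hs P hP
    refine ⟨t, ht, fun P' hP' ω hω => ?_⟩
    rcases Finset.mem_insert.1 hP' with rfl | hP'S
    · exact h1 ω hω
    · have hne : P' ≠ P := by rintro rfl; exact hPS hP'S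
      have hd := Q.disjoint (hS hP') hP hne
      rw [h2 ω (Finset.mem_compl.2 (Finset.disjoint_left.1 hd hω)), hsS P' hP'S ω hω]

/-- Gluing maximizers of the separate cells gives a prior in `N` that attains every `upperProb N (A
∩ P)`, hence `q` attains them too. Coherence makes `q` a multiple of `p` on `A ∩ P`, and the mass
fixes the multiple. -/
theorem IsRich.eq_mul_of_coherent (hrich : IsRich p Q N) (hcons : IsConsistent p Q N)
    {A : Finset Ω} {q : Ω → ℝ} (hq : q ∈ maxLik N A)
    (hcoh : ∀ P ∈ Q.parts, ∀ ω ∈ A ∩ P, ∀ ω' ∈ A ∩ P, q ω / q ω' = p ω / p ω') :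
    ∀ P ∈ Q.parts, ∀ ω ∈ A ∩ P, q ω = upperProb N (A ∩ P) / prob p (A ∩ P) * p ω := by
  obtain ⟨s, hs, hsr⟩ : ∃ s ∈ N, ∀ P ∈ Q.parts, prob s (A ∩ P) = upperProb N (A ∩ P) := by
    have hex : ∀ P, ∃ q, P ∈ Q.parts → q ∈ N ∧ prob q (A ∩ P) = upperProb N (A ∩ P) := by
      intro P
      by_cases hP : P ∈ Q.parts
      · obtain ⟨q, hq, h, -⟩ :=
          hrich.exists_prob_eq_upperProb (D := A ∩ P) hP Finset.inter_subset_right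
        exact ⟨q, fun _ => ⟨hq, h⟩⟩
      · exact ⟨p, fun h => absurd h hP⟩
    choose r hr using hex
    obtain ⟨s, hs, hsr⟩ := hrich.exists_glue ⟨p, hcons.benchmark_mem⟩ r fun P hP => (hr P hP).1
    refine ⟨s, hs, fun P hP => ?_⟩
    rw [← (hr P hP).2]
    exact prob_congr fun ω hω => hsr P hP ω (Finset.mem_inter.1 hω).2
  have hqA := prob_inter_eq_of_mem_maxLik hrich.prob_le_upperProb hs hsr hq
  intro P hP ω hω
  have hpA := prob_pos hcons.full_support ⟨ω, hω⟩
  have hqpos : 0 < prob q (A ∩ P) := by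
    rw [hqA P hP]
    exact hpA.trans_le (hrich.prob_le_upperProb p hcons.benchmark_mem P hP _
      Finset.inter_subset_right)
  -- The ratios are taken against a state of nonzero mass, so that no division by zero occurs.
  obtain ⟨ω₀, hω₀, hne⟩ := Finset.exists_ne_zero_of_sum_ne_zero hqpos.ne'
  have hlin : ∀ x ∈ A ∩ P, q x = q ω₀ / p ω₀ * p x := by
    intro x hx
    have h := hcoh P hP x hx ω₀ hω₀
    have h0 := (hcons.full_support ω₀).ne'
    field_simp at h ⊢
    linarith
  rw [← hqA P hP, prob_congr hlin, prob_mul_left, mul_div_assoc, div_self hpA.ne', mul_one]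
  exact hlin ω hω

/-- `ratio` evaluates at `D` the prior-coherent maximizer of `D'`. `submod` uses one prior that
attains the bounds of both members of the chain `S ∩ T ⊆ S ∪ T`, together with additivity of that
prior. `strict` is non-extremeness. -/
theorem IsRich.isUpper (hrich : IsRich p Q N) (hcons : IsConsistent p Q N) :
    IsUpper p Q (upperProb N) where
  simplex := hcons.prior_mem
  full_support := hcons.full_support
  empty := by
    rw [upperProb_eq hcons.benchmark_mem, prob_empty]
    simp
  cell := fun P hP => upperProb_eq hcons.benchmark_mem fun r hr => (hcons.agree r hr P hP).le
  mono := fun P hP D D' hDD' hD' => by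
    obtain ⟨q, hq, h, -⟩ := hrich.exists_prob_eq_upperProb hP (hDD'.trans hD')
    rw [← h]
    exact (prob_mono (hcons.subset_simplex hq).1 hDD').trans
      (hrich.prob_le_upperProb q hq P hP D' hD')
  ratio := fun P hP D D' hDD' hD' => by
    rcases D'.eq_empty_or_nonempty with rfl | hne
    · simp [Finset.subset_empty.1 hDD']
    obtain ⟨q, hq, hcoh⟩ := hrich.prior_coherent D' hne
    have h := hrich.eq_mul_of_coherent hcons hq hcoh P hP
    rw [Finset.inter_eq_left.2 hD'] at h
    have hle := hrich.prob_le_upperProb q hq.1 P hP D (hDD'.trans hD')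
    rwa [prob_congr fun ω hω => h ω (hDD' hω), prob_mul_left, div_mul_eq_mul_div,
      div_le_iff₀ (prob_pos hcons.full_support hne)] at hle
  submod := fun P hP S T hS hT => by
    have hmono : Monotone ![S ∩ T, S ∪ T] := by
      intro i j hij
      fin_cases i <;> fin_cases j
      · exact subset_rfl
      · exact Finset.inter_subset_left.trans Finset.subset_union_left
      · exact absurd hij (by decide)
      · exact subset_rfl
    obtain ⟨q, hq, h⟩ := hrich.exists_chain hP hmono fun i => by
      fin_cases i
      · exact Finset.inter_subset_left.trans hS
      · exact Finset.union_subset hS hT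
    have h0 := h 0
    have h1 := h 1
    simp only [Matrix.cons_val_zero, Matrix.cons_val_one] at h0 h1
    rw [← h0, ← h1]
    have : prob q (S ∪ T) + prob q (S ∩ T) = prob q S + prob q T := Finset.sum_union_inter
    rw [this]
    exact add_le_add (hrich.prob_le_upperProb q hq P hP S hS)
      (hrich.prob_le_upperProb q hq P hP T hT)
  strict := fun P hP D hne hD => by
    obtain ⟨-, -, r, hr, -, h⟩ := hrich.non_extreme P hP D hne hD
    exact h.trans_le (hrich.prob_le_upperProb r hr P hP D hD.1)

theorem IsRichRML.represents {post : Finset Ω → Ω → ℝ} (h : IsRichRML post p Q N) :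
    Represents post p Q (upperProb N) := by
  obtain ⟨⟨hcons, hpost⟩, hrich⟩ := h
  have hu := hrich.isUpper hcons
  intro A hA
  obtain ⟨q, hq, hcoh⟩ := hrich.prior_coherent A hA
  have hqA := hrich.eq_mul_of_coherent hcons hq hcoh
  have e := hu.klArgmin_eq hcons.subset_simplex hrich.prob_le_upperProb hA hq.1 hqA
  rw [hpost A hA, Set.singleton_eq_singleton_iff] at e
  rw [e]
  exact ⟨fun ω hω => if_neg hω, fun P hP ω hω => hu.bayes_apply hqA hP hω⟩

/-- A prior in `N` that attains the bounds of all initial segments of an order on `P` is greedy on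
`P`. Convexity then yields every restriction of the polytope to one cell, and rectangularity
combines the cells. -/
theorem IsRich.eq_basePolytope (hrich : IsRich p Q N) (hcons : IsConsistent p Q N) :
    N = basePolytope p Q (upperProb N) := by
  have hu := hrich.isUpper hcons
  refine Set.Subset.antisymm (fun q hq => ⟨hcons.subset_simplex hq, fun P hP =>
    ⟨hcons.agree q hq P hP, hrich.prob_le_upperProb q hq P hP⟩⟩) fun q hq => ?_
  have key : ∀ P ∈ Q.parts, ∃ r ∈ N, ∀ ω ∈ P, r ω = q ω := by
    intro P hP
    have hmem := hu.restrict_mem_convexHull_greedy hP (hq.2 P hP).1 (hq.2 P hP).2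
    have hconv : Convex ℝ ((fun (r : Ω → ℝ) (ω : P) => r ω) '' N) :=
      hcons.convex.is_linear_image ⟨fun _ _ => rfl, fun _ _ => rfl⟩
    suffices hsub : (Set.range fun (σ : Ω ≃ Fin (Fintype.card Ω)) (ω : P) =>
        greedy Q (upperProb N) σ ω) ⊆
        (fun (r : Ω → ℝ) (ω : P) => r ω) '' N by
      obtain ⟨r, hr, hrq⟩ := convexHull_min hsub hconv hmem
      exact ⟨r, hr, fun ω hω => congrFun hrq ⟨ω, hω⟩⟩
    rintro _ ⟨σ, rfl⟩
    -- With one more index than states, both the strict and the weak predecessors of each state are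
    -- members of the chain.
    let D : Fin (Fintype.card Ω + 1) → Finset Ω := fun i => {ω ∈ P | (σ ω).castSucc < i}
    have hD : Monotone D := fun i j hij =>
      Finset.monotone_filter_right P fun x _ hx => lt_of_lt_of_le hx hij
    obtain ⟨r, hr, hrD⟩ := hrich.exists_chain hP hD fun i => Finset.filter_subset _ _
    refine ⟨r, hr, ?_⟩
    funext ω
    have e1 : ({x ∈ P | σ x ≤ σ ω} : Finset Ω) = D (σ ω).succ := by
      simp only [D, Fin.castSucc_lt_succ_iff]
    have e2 : ({x ∈ P | σ x < σ ω} : Finset Ω) = D (σ ω).castSucc := by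
      simp only [D, Fin.castSucc_lt_castSucc_iff]
    show r ω = greedy Q (upperProb N) σ ω
    rw [greedy_of_mem hP ω.2, e1, e2, ← hrD, ← hrD, ← e1, ← e2]
    have hI : ({x ∈ P | σ x ≤ σ ω} : Finset Ω) =
        insert (ω : Ω) ({x ∈ P | σ x < σ ω} : Finset Ω) := by
      ext x
      simp only [Finset.mem_filter, Finset.mem_insert]
      constructor
      · rintro ⟨hx, hle⟩
        rcases hle.lt_or_eq with hlt | heq
        · exact Or.inr ⟨hx, hlt⟩
        · exact Or.inl (σ.injective heq)
      · rintro (rfl | ⟨hx, hlt⟩)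
        · exact ⟨ω.2, le_rfl⟩
        · exact ⟨hx, hlt.le⟩
    rw [hI, prob, Finset.sum_insert (by simp), prob]
    ring
  have hex : ∀ P, ∃ r, P ∈ Q.parts → r ∈ N ∧ ∀ ω ∈ P, r ω = q ω := by
    intro P
    by_cases hP : P ∈ Q.parts
    · obtain ⟨r, hr⟩ := key P hP
      exact ⟨r, fun _ => hr⟩
    · exact ⟨p, fun h => absurd h hP⟩
  choose r hr using hex
  obtain ⟨s, hs, hsr⟩ := hrich.exists_glue ⟨p, hcons.benchmark_mem⟩ r fun P hP => (hr P hP).1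
  have : s = q := by
    funext ω
    obtain ⟨P, hP, hω⟩ := Q.exists_mem (Finset.mem_univ ω)
    rw [hsr P hP ω hω, (hr P hP).2 ω hω]
  exact this ▸ hs

end Rich

/-! ### Bayesian updating -/

/-- Singleton cells have no nonempty proper subsets, so consistency and non-extremeness require no
ambiguity. This replaces the trivial partition when updating is Bayesian. -/
theorem isRichRML_bayes {post : Finset Ω → Ω → ℝ} {p : Ω → ℝ} (hp : p ∈ stdSimplex ℝ Ω)
    (hpos : ∀ ω, 0 < p ω) (hpost : ∀ A : Finset Ω, A.Nonempty → post A = bayes p A) :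
    IsRichRML post p ⊥ {p} := by
  have hcell : ∀ P ∈ (⊥ : Finpartition (univ : Finset Ω)).parts, ∀ D : Finset Ω, D.Nonempty →
      ¬ D ⊂ P := by
    intro P hP D hne hD
    obtain ⟨a, -, rfl⟩ := Finpartition.mem_bot_iff.1 hP
    exact hne.ne_empty (Finset.ssubset_singleton_iff.1 hD)
  have hmax : ∀ A : Finset Ω, p ∈ maxLik {p} A := fun A =>
    ⟨rfl, fun r hr => by rw [Set.mem_singleton_iff.1 hr]⟩
  refine ⟨⟨⟨hp, hpos, by simpa using hp, isClosed_singleton, convex_singleton p, rfl, ?_, ?_⟩, ?_⟩,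
    ⟨?_, ?_, ?_, ?_⟩⟩
  · rintro q rfl P _
    rfl
  · exact fun P hP D hne hD => absurd hD (hcell P hP D hne)
  · intro A hA
    have e : maxLikPosteriors {p} A = {bayes p A} := by
      rw [maxLikPosteriors, Set.eq_singleton_iff_unique_mem]
      refine ⟨⟨p, hmax A, rfl⟩, ?_⟩
      rintro _ ⟨r, hr, rfl⟩
      rw [Set.mem_singleton_iff.1 hr.1]
    rw [hpost A hA, klArgmin, e]
    ext x
    constructor
    · exact fun hx => hx.1
    · rintro rfl
      exact ⟨rfl, fun r hr => by rw [Set.mem_singleton_iff.1 hr]⟩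
  · exact fun P hP D hne hD => absurd hD (hcell P hP D hne)
  · exact fun A _ => ⟨p, hmax A, fun _ _ _ _ _ _ => rfl⟩
  · exact fun P _ m D _ _ => ⟨p, rfl, fun i => (hmax (D i)).2⟩
  · rintro q rfl r rfl P _
    exact ⟨r, rfl, r, rfl, fun _ _ => rfl, fun _ _ => rfl, fun _ _ => rfl, fun _ _ => rfl⟩

theorem Represents.eq_bayes {post : Finset Ω → Ω → ℝ} {p : Ω → ℝ}
    {Q : Finpartition (univ : Finset Ω)} {u : Finset Ω → ℝ} (hr : Represents post p Q u)
    (hu : IsUpper p Q u) (hQ : Q.parts = {univ}) {A : Finset Ω} (hA : A.Nonempty) :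
    post A = bayes p A := by
  have huniv : (univ : Finset Ω) ∈ Q.parts := by simp [hQ]
  funext ω
  by_cases hω : ω ∈ A
  · have ht := hu.total_pos hA
    have e : total Q u A = u A := by simp [total, hQ]
    rw [e] at ht
    rw [(hr A hA).2 univ huniv ω (by simpa using hω), Finset.inter_univ, e, div_self ht.ne',
      one_mul, bayes, if_pos hω]
  · rw [(hr A hA).1 ω hω, bayes, if_neg hω]

theorem ne_univ_of_mem_parts {Q : Finpartition (univ : Finset Ω)} (hQ : Q.parts ≠ {univ})
    {P : Finset Ω} (hP : P ∈ Q.parts) : P ≠ univ := by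
  rintro rfl
  refine hQ (Finset.eq_singleton_iff_unique_mem.2 ⟨hP, fun P' hP' => ?_⟩)
  obtain ⟨x, hx⟩ := Q.nonempty_of_mem_parts hP'
  exact Q.eq_of_mem_parts hP' hP hx (Finset.mem_univ x)

theorem IsRichRML.satisfiesAxioms {post : Finset Ω → Ω → ℝ} {p : Ω → ℝ}
    {Q : Finpartition (univ : Finset Ω)} {N : Set (Ω → ℝ)}
    (hpost : ∀ A : Finset Ω, A.Nonempty → post A ∈ stdSimplex ℝ Ω)
    (h : IsRichRML post p Q N) : SatisfiesAxioms post := by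
  have hu := h.2.isUpper h.1.consistent
  have hr := h.represents
  by_cases hQ : Q.parts = {univ}
  -- The cell `univ` offers no outside state for `Represents.generates`; the partition into
  -- singletons meets its hypothesis vacuously.
  · have h' := isRichRML_bayes hu.simplex hu.full_support fun A hA => hr.eq_bayes hu hQ hA
    refine h'.represents.satisfiesAxioms (h'.2.isUpper h'.1.consistent) hpost fun P hP D hne hD => ?_
    obtain ⟨a, -, rfl⟩ := Finpartition.mem_bot_iff.1 hP
    exact absurd (Finset.ssubset_singleton_iff.1 hD) hne.ne_empty
  · refine hr.satisfiesAxioms hu hpost fun P hP _ _ _ => ?_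
    by_contra hall
    push Not at hall
    exact ne_univ_of_mem_parts hQ hP (Finset.eq_univ_iff_forall.2 hall)

/-! ### The upper probability revealed by the posteriors -/

section Reveal

variable {post : Finset Ω → Ω → ℝ} {Q : Finpartition (univ : Finset Ω)}

theorem Regularity.eq_zero (hreg : Regularity post)
    (hpost : ∀ A : Finset Ω, A.Nonempty → post A ∈ stdSimplex ℝ Ω) {A : Finset Ω}
    (hA : A.Nonempty) {ω : Ω} (hω : ω ∉ A) : post A ω = 0 := by
  have h : prob (post A) Aᶜ = 0 := by rw [prob_compl (hpost A hA), (hreg A hA).2, sub_self]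
  exact (Finset.sum_eq_zero_iff_of_nonneg fun ω _ => (hpost A hA).1 ω).1 h ω
    (Finset.mem_compl.2 hω)

theorem Regularity.prob_pos (hreg : Regularity post)
    (hpost : ∀ A : Finset Ω, A.Nonempty → post A ∈ stdSimplex ℝ Ω) {A B : Finset Ω}
    (h : (A ∩ B).Nonempty) : 0 < prob (post A) B := by
  have hA : A.Nonempty := h.mono Finset.inter_subset_left
  rw [prob_inter_of_support fun ω hω => hreg.eq_zero hpost hA hω]
  exact Finset.sum_pos (fun ω hω => (hreg A hA).1 ω (Finset.mem_inter.1 hω).1) h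

/-- Idealness at `A` and at `univ` equates the two conditionals on `E`. -/
theorem IsIdealEvent.eq_prob_mul {E A : Finset Ω} (hE : IsIdealEvent post E)
    (hreg : Regularity post)
    (hpost : ∀ A : Finset Ω, A.Nonempty → post A ∈ stdSimplex ℝ Ω) (hEA : E ⊆ A) {ω : Ω}
    (hω : ω ∈ E) :
    post A ω = prob (post A) E * (post univ ω / prob (post univ) E) := by
  have hA : A.Nonempty := ⟨ω, hEA hω⟩
  have h1 := hE A hA hEA ω hω
  have h2 := hE univ (hA.mono (Finset.subset_univ A)) (Finset.subset_univ E) ω hω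
  rw [bayes, if_pos hω] at h1 h2
  have h3 : 0 < prob (post A) E :=
    hreg.prob_pos hpost ⟨ω, Finset.mem_inter.2 ⟨hEA hω, hω⟩⟩
  rw [← h2, h1]
  field_simp

theorem IsIdealEvent.prob_eq_prob_mul {E A D : Finset Ω} (hE : IsIdealEvent post E)
    (hreg : Regularity post)
    (hpost : ∀ A : Finset Ω, A.Nonempty → post A ∈ stdSimplex ℝ Ω) (hEA : E ⊆ A) (hD : D ⊆ E) :
    prob (post A) D = prob (post A) E * (prob (post univ) D / prob (post univ) E) := by
  have : prob (post A) D = ∑ ω ∈ D, prob (post A) E / prob (post univ) E * post univ ω :=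
    Finset.sum_congr rfl fun ω hω => by rw [hE.eq_prob_mul hreg hpost hEA (hD hω)]; ring
  rw [this, ← Finset.mul_sum]
  unfold prob
  ring

theorem revealedUpper_nonneg
    (hpost : ∀ A : Finset Ω, A.Nonempty → post A ∈ stdSimplex ℝ Ω) {P : Finset Ω}
    (hP : P ≠ univ) (D : Finset Ω) : 0 ≤ revealedUpper post P D := by
  have hne : Pᶜ.Nonempty := by rwa [Finset.nonempty_iff_ne_empty, Ne, Finset.compl_eq_empty_iff]
  have h := (hpost (Pᶜ ∪ D) (hne.mono Finset.subset_union_left)).1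
  exact div_nonneg (mul_nonneg (prob_nonneg h _)
    (prob_nonneg (hpost univ (hne.mono (Finset.subset_univ _))).1 _)) (prob_nonneg h _)

theorem revealedUpper_eq_odds_mul
    (hpost : ∀ A : Finset Ω, A.Nonempty → post A ∈ stdSimplex ℝ Ω) {P : Finset Ω}
    (hP : P ≠ univ) (D : Finset Ω) :
    revealedUpper post P D = odds post P (Pᶜ ∪ D) * prob (post univ) Pᶜ := by
  have hne : Pᶜ.Nonempty := by rwa [Finset.nonempty_iff_ne_empty, Ne, Finset.compl_eq_empty_iff]
  rw [revealedUpper, odds, ← prob_compl (hpost _ (hne.mono Finset.subset_union_left))]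
  ring

theorem Generates.isSymmIdeal_cell (hgen : Generates post Q) {P : Finset Ω} (hP : P ∈ Q.parts) :
    IsSymmIdeal post P :=
  (hgen P).2 ⟨{P}, by simpa using hP, by simp⟩

theorem SatisfiesAxioms.isIdealEvent_of_subset (hax : SatisfiesAxioms post)
    (hgen : Generates post Q) {P D : Finset Ω} (hP : P ∈ Q.parts) (hD : D ⊆ P) :
    IsIdealEvent post D := by
  rcases eq_or_ssubset_of_subset hD with rfl | h
  · exact (hgen.isSymmIdeal_cell hP).1
  · exact hax.idealness P (parts_eq_of_generating hgen ▸ hP) D h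

/-- The upper probabilities that the posteriors reveal for the cells of `Q`, as a single set
function. -/
noncomputable def cellUpper (post : Finset Ω → Ω → ℝ) (Q : Finpartition (univ : Finset Ω))
    (D : Finset Ω) : ℝ :=
  ∑ P ∈ Q.parts, revealedUpper post P (D ∩ P)

theorem revealedUpper_empty (hreg : Regularity post)
    (hpost : ∀ A : Finset Ω, A.Nonempty → post A ∈ stdSimplex ℝ Ω) {P : Finset Ω}
    (hP : P ≠ univ) : revealedUpper post P ∅ = 0 := by
  have hne : Pᶜ.Nonempty := by rwa [Finset.nonempty_iff_ne_empty, Ne, Finset.compl_eq_empty_iff]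
  rw [revealedUpper, Finset.union_empty,
    prob_inter_of_support (fun ω hω => hreg.eq_zero hpost hne hω) P, Finset.inter_comm,
    Finset.inter_compl, prob_empty, zero_mul, zero_div]

theorem cellUpper_eq (hreg : Regularity post)
    (hpost : ∀ A : Finset Ω, A.Nonempty → post A ∈ stdSimplex ℝ Ω) (hQ : Q.parts ≠ {univ})
    {P D : Finset Ω} (hP : P ∈ Q.parts) (hD : D ⊆ P) :
    cellUpper post Q D = revealedUpper post P D := by
  rw [cellUpper, Finset.sum_eq_single_of_mem P hP, Finset.inter_eq_left.2 hD]
  intro P' hP' hne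
  have : D ∩ P' = ∅ := Finset.disjoint_iff_inter_eq_empty.1
    ((Q.disjoint hP hP' hne.symm).mono_left hD)
  rw [this, revealedUpper_empty hreg hpost (ne_univ_of_mem_parts hQ hP')]

variable (hax : SatisfiesAxioms post)
  (hpost : ∀ A : Finset Ω, A.Nonempty → post A ∈ stdSimplex ℝ Ω)
  (hgen : Generates post Q) (hQ : Q.parts ≠ {univ})
include hax hpost hgen hQ

/-- Betweenness at `Pᶜ ∪ D'` with `D' \ D` removed. Its first inequality compares odds and gives
monotonicity; in the second, idealness of `D'` expresses the conditioned mass of `D` through the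
prior. The case `D = ∅` is separate because only a proper subset of `A ∩ P` may be removed. -/
theorem revealedUpper_mono_and_ratio {P D D' : Finset Ω} (hP : P ∈ Q.parts) (hDD' : D ⊆ D')
    (hD' : D' ⊆ P) :
    revealedUpper post P D ≤ revealedUpper post P D' ∧
      revealedUpper post P D' * prob (post univ) D ≤
        revealedUpper post P D * prob (post univ) D' := by
  have hreg := hax.regularity
  have hPu := ne_univ_of_mem_parts hQ hP
  have hne : Pᶜ.Nonempty := by rwa [Finset.nonempty_iff_ne_empty, Ne, Finset.compl_eq_empty_iff]
  rcases D.eq_empty_or_nonempty with rfl | hDne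
  · rw [revealedUpper_empty hreg hpost hPu, prob_empty, mul_zero, zero_mul]
    exact ⟨revealedUpper_nonneg hpost hPu D', le_rfl⟩
  have hA : (Pᶜ ∪ D').Nonempty := hne.mono Finset.subset_union_left
  have hB : (Pᶜ ∪ D).Nonempty := hne.mono Finset.subset_union_left
  have hAP : (Pᶜ ∪ D') ∩ P = D' := by
    ext x
    have : x ∈ D' → x ∈ P := fun h => hD' h
    simp only [Finset.mem_inter, Finset.mem_union, Finset.mem_compl]
    tauto
  have hBP : (Pᶜ ∪ D) ∩ P = D := by
    ext x
    have : x ∈ D → x ∈ P := fun h => hD' (hDD' h)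
    simp only [Finset.mem_inter, Finset.mem_union, Finset.mem_compl]
    tauto
  have hsd : (Pᶜ ∪ D') \ (D' \ D) = Pᶜ ∪ D := by
    ext x
    have h1 : x ∈ D' → x ∈ P := fun h => hD' h
    have h2 : x ∈ D → x ∈ D' := fun h => hDD' h
    simp only [Finset.mem_sdiff, Finset.mem_union, Finset.mem_compl]
    tauto
  have hss : D' \ D ⊂ (Pᶜ ∪ D') ∩ P := by
    rw [hAP]
    refine ⟨Finset.sdiff_subset, fun h => ?_⟩
    obtain ⟨x, hx⟩ := hDne
    exact (Finset.mem_sdiff.1 (h (hDD' hx))).2 hx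
  obtain ⟨h1, h2⟩ := hax.betweenness _ hA P (parts_eq_of_generating hgen ▸ hP) _ hss
  rw [hsd] at h1 h2
  have hy : 0 < prob (post (Pᶜ ∪ D')) Pᶜ :=
    hreg.prob_pos hpost (hne.mono (Finset.subset_inter Finset.subset_union_left subset_rfl))
  have hy' : 0 < prob (post (Pᶜ ∪ D)) Pᶜ :=
    hreg.prob_pos hpost (hne.mono (Finset.subset_inter Finset.subset_union_left subset_rfl))
  have hc : 0 < prob (post univ) Pᶜ := hreg.prob_pos hpost (by rwa [Finset.univ_inter])
  have hx : 0 < prob (post (Pᶜ ∪ D')) P :=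
    hreg.prob_pos hpost (by rw [hAP]; exact hDne.mono hDD')
  have hx' : 0 < prob (post (Pᶜ ∪ D)) P := hreg.prob_pos hpost (by rwa [hBP])
  have hpD : 0 < prob (post univ) D := hreg.prob_pos hpost (by rwa [Finset.univ_inter])
  have hpD' : 0 < prob (post univ) D' :=
    hreg.prob_pos hpost (by rw [Finset.univ_inter]; exact hDne.mono hDD')
  have e := prob_compl (hpost _ hA) P
  have e' := prob_compl (hpost _ hB) P
  have hid := (hax.isIdealEvent_of_subset hgen hP hD').prob_eq_prob_mul hreg hpost
    (A := Pᶜ ∪ D') Finset.subset_union_right hDD'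
  have hxD' : prob (post (Pᶜ ∪ D')) D' = prob (post (Pᶜ ∪ D')) P := by
    rw [prob_inter_of_support (fun ω hω => hreg.eq_zero hpost hA hω) P, hAP]
  have hd : Disjoint Pᶜ D := Finset.disjoint_left.2 fun x hx hxD =>
    Finset.mem_compl.1 hx (hD' (hDD' hxD))
  have hb : prob (bayes (post (Pᶜ ∪ D')) (Pᶜ ∪ D)) P =
      prob (post (Pᶜ ∪ D')) D / (prob (post (Pᶜ ∪ D')) Pᶜ + prob (post (Pᶜ ∪ D')) D) := by
    rw [prob_inter_of_support (A := Pᶜ ∪ D) fun ω hω => by simp [bayes, hω], hBP,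
      ← prob_union hd, prob, prob, Finset.sum_div]
    exact Finset.sum_congr rfl fun ω hω => by simp [bayes, hω]
  rw [hb, hid, hxD'] at h2
  unfold revealedUpper
  -- Masses of `P` and `Pᶜ` are `x`, `y` given `Pᶜ ∪ D'` and `x'`, `y'` given `Pᶜ ∪ D`; the prior
  -- masses of `Pᶜ`, `D`, `D'` are `c`, `d`, `d'`.
  generalize prob (post (Pᶜ ∪ D')) P = x at *
  generalize prob (post (Pᶜ ∪ D')) Pᶜ = y at *
  generalize prob (post (Pᶜ ∪ D)) P = x' at *
  generalize prob (post (Pᶜ ∪ D)) Pᶜ = y' at *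
  generalize prob (post univ) Pᶜ = c at *
  generalize prob (post univ) D = d at *
  generalize prob (post univ) D' = d' at *
  constructor
  · rw [div_le_div_iff₀ hy' hy]
    have : x' * y ≤ x * y' := by rw [e, e']; linarith
    nlinarith
  · have ht : 0 < x * (d / d') := by positivity
    rw [div_le_iff₀ (by linarith)] at h2
    have h3 : x * (d / d') * y' ≤ x' * y := by rw [e']; linarith
    have h4 : x * d * y' ≤ x' * y * d' := by
      have : x * (d / d') * y' * d' = x * d * y' := by field_simp
      rw [← this]
      exact mul_le_mul_of_nonneg_right h3 hpD'.le
    rw [div_mul_eq_mul_div, div_mul_eq_mul_div, div_le_div_iff₀ hy hy']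
    nlinarith

/-- Submodularity at `Pᶜ ∪ (S ∪ T)` with `T \ S` and `S \ T` removed: the four events are `Pᶜ`
joined with `S ∪ T`, `S ∩ T`, `S` and `T`. -/
theorem revealedUpper_submod {P S T : Finset Ω} (hP : P ∈ Q.parts) (hS : S ⊆ P) (hT : T ⊆ P) :
    revealedUpper post P (S ∪ T) + revealedUpper post P (S ∩ T) ≤
      revealedUpper post P S + revealedUpper post P T := by
  have hreg := hax.regularity
  have hPu := ne_univ_of_mem_parts hQ hP
  have hne : Pᶜ.Nonempty := by rwa [Finset.nonempty_iff_ne_empty, Ne, Finset.compl_eq_empty_iff]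
  have hc : 0 ≤ prob (post univ) Pᶜ :=
    prob_nonneg (hpost univ (hne.mono (Finset.subset_univ _))).1 _
  have key : ∀ B C : Finset Ω, B ⊆ P → C = (S ∪ T) \ B →
      (Pᶜ ∪ (S ∪ T)) \ B = Pᶜ ∪ C := by
    rintro B C hB rfl
    ext x
    have : x ∈ B → x ∈ P := fun h => hB h
    simp only [Finset.mem_sdiff, Finset.mem_union, Finset.mem_compl]
    tauto
  have h := hax.submodularity (Pᶜ ∪ (S ∪ T)) P (parts_eq_of_generating hgen ▸ hP)
    (hne.mono fun x hx => Finset.mem_sdiff.2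
      ⟨Finset.mem_union_left _ hx, Finset.mem_compl.1 hx⟩) (T \ S) (S \ T)
    (Finset.sdiff_subset.trans hT) (Finset.sdiff_subset.trans hS)
    (by ext x; simp only [Finset.mem_inter, Finset.mem_sdiff, Finset.notMem_empty]; tauto)
  rw [key (T \ S ∪ S \ T) (S ∩ T)
      (Finset.union_subset (Finset.sdiff_subset.trans hT) (Finset.sdiff_subset.trans hS))
      (by ext x; simp only [Finset.mem_inter, Finset.mem_sdiff, Finset.mem_union]; tauto),
    key (T \ S) S (Finset.sdiff_subset.trans hT)
      (by ext x; simp only [Finset.mem_sdiff, Finset.mem_union]; tauto),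
    key (S \ T) T (Finset.sdiff_subset.trans hS)
      (by ext x; simp only [Finset.mem_sdiff, Finset.mem_union]; tauto)] at h
  simp only [revealedUpper_eq_odds_mul hpost hPu, ← add_mul]
  exact mul_le_mul_of_nonneg_right h hc

theorem revealedUpper_cell {P : Finset Ω} (hP : P ∈ Q.parts) :
    revealedUpper post P P = prob (post univ) P := by
  have hPu := ne_univ_of_mem_parts hQ hP
  have hne : Pᶜ.Nonempty := by rwa [Finset.nonempty_iff_ne_empty, Ne, Finset.compl_eq_empty_iff]
  have hc : 0 < prob (post univ) Pᶜ := hax.regularity.prob_pos hpost (by rwa [Finset.univ_inter])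
  rw [revealedUpper, Finset.union_comm, Finset.union_compl]
  exact mul_div_cancel_right₀ _ hc.ne'

/-- Otherwise `(P \ D)ᶜ` would be ideal. As `P \ D` is ideal by Idealness, it would be a
symmetrically ideal event strictly inside the minimal event `P`. -/
theorem prob_lt_revealedUpper {P D : Finset Ω} (hP : P ∈ Q.parts) (hDne : D.Nonempty)
    (hD : D ⊂ P) : prob (post univ) D < revealedUpper post P D := by
  have hreg := hax.regularity
  have hPu := ne_univ_of_mem_parts hQ hP
  have hne : Pᶜ.Nonempty := by rwa [Finset.nonempty_iff_ne_empty, Ne, Finset.compl_eq_empty_iff]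
  have hpos : ∀ X : Finset Ω, X.Nonempty → 0 < prob (post univ) X := fun X hX =>
    hreg.prob_pos hpost (by rwa [Finset.univ_inter])
  have hle : ∀ X ⊆ P, prob (post univ) X ≤ revealedUpper post P X := by
    intro X hX
    have h := (revealedUpper_mono_and_ratio hax hpost hgen hQ hP hX subset_rfl).2
    rw [revealedUpper_cell hax hpost hgen hQ hP, mul_comm] at h
    exact le_of_mul_le_mul_right h (hpos P (Q.nonempty_of_mem_parts hP))
  by_contra hlt
  have hideal : IsIdealEvent post (P \ D)ᶜ := by
    refine isIdealEvent_of_proportional (p := post univ) hreg fun A hA hEA => ?_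
    have hPA : Pᶜ ⊆ A := fun x hx => hEA (by
      simp only [Finset.mem_compl, Finset.mem_sdiff] at hx ⊢
      tauto)
    have hDA : D ⊆ A := fun x hx => hEA (by
      simp only [Finset.mem_compl, Finset.mem_sdiff]
      tauto)
    have hDX : D ⊆ A ∩ P := Finset.subset_inter hDA hD.1
    have hAeq : Pᶜ ∪ A ∩ P = A := by
      ext x
      have : x ∉ P → x ∈ A := fun h => hPA (Finset.mem_compl.2 h)
      simp only [Finset.mem_inter, Finset.mem_union, Finset.mem_compl]
      tauto
    have hpX := hpos _ (hDne.mono hDX)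
    have hpc := hpos _ hne
    have hy : 0 < prob (post A) Pᶜ :=
      hreg.prob_pos hpost (hne.mono (Finset.subset_inter hPA subset_rfl))
    -- As `revealedUpper / prob` decreases, equality with the prior at `D` propagates to every set
    -- between `D` and `P`.
    have hX : revealedUpper post P (A ∩ P) = prob (post univ) (A ∩ P) := by
      refine le_antisymm ?_ (hle _ Finset.inter_subset_right)
      have h := (revealedUpper_mono_and_ratio hax hpost hgen hQ hP hDX
        Finset.inter_subset_right).2
      have h' := mul_le_mul_of_nonneg_right (not_lt.1 hlt) hpX.le
      rw [mul_comm (prob (post univ) D)] at h'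
      exact le_of_mul_le_mul_right (h.trans h') (hpos D hDne)
    rw [revealedUpper, hAeq, prob_inter_of_support (fun ω hω => hreg.eq_zero hpost hA hω) P,
      div_eq_iff hy.ne'] at hX
    refine ⟨prob (post A) Pᶜ / prob (post univ) Pᶜ, (div_pos hy hpc).ne', fun ω hω => ?_⟩
    by_cases hωP : ω ∈ P
    · have hωX : ω ∈ A ∩ P := Finset.mem_inter.2 ⟨hEA hω, hωP⟩
      rw [(hax.isIdealEvent_of_subset hgen hP Finset.inter_subset_right).eq_prob_mul hreg hpost
        Finset.inter_subset_left hωX]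
      field_simp
      linear_combination (post univ ω) * hX
    · rw [(hgen.isSymmIdeal_cell hP).2.eq_prob_mul hreg hpost hPA (Finset.mem_compl.2 hωP)]
      ring
  have hmem : P ∈ revealedPartition post := parts_eq_of_generating hgen ▸ hP
  have hsub := hmem.2 ⟨Finset.sdiff_nonempty.2 hD.2,
    hax.isIdealEvent_of_subset hgen hP Finset.sdiff_subset, hideal⟩ Finset.sdiff_subset
  obtain ⟨x, hx⟩ := hDne
  exact (Finset.mem_sdiff.1 (hsub (hD.1 hx))).2 hx

theorem isUpper_cellUpper [Nonempty Ω] : IsUpper (post univ) Q (cellUpper post Q) := by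
  have hreg := hax.regularity
  have e := fun {P D : Finset Ω} (hP : P ∈ Q.parts) (hD : D ⊆ P) =>
    cellUpper_eq hreg hpost hQ hP hD
  exact
    { simplex := hpost univ Finset.univ_nonempty
      full_support := fun ω => (hreg univ Finset.univ_nonempty).1 ω (Finset.mem_univ ω)
      empty := Finset.sum_eq_zero fun P hP => by
        rw [Finset.empty_inter, revealedUpper_empty hreg hpost (ne_univ_of_mem_parts hQ hP)]
      cell := fun P hP => by rw [e hP subset_rfl, revealedUpper_cell hax hpost hgen hQ hP]
      mono := fun P hP D D' h h' => by
        rw [e hP (h.trans h'), e hP h']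
        exact (revealedUpper_mono_and_ratio hax hpost hgen hQ hP h h').1
      ratio := fun P hP D D' h h' => by
        rw [e hP (h.trans h'), e hP h']
        exact (revealedUpper_mono_and_ratio hax hpost hgen hQ hP h h').2
      submod := fun P hP S T hS hT => by
        rw [e hP hS, e hP hT, e hP (Finset.union_subset hS hT),
          e hP (Finset.inter_subset_left.trans hS)]
        exact revealedUpper_submod hax hpost hgen hQ hP hS hT
      strict := fun P hP D hne hD => by
        rw [e hP hD.1]
        exact prob_lt_revealedUpper hax hpost hgen hQ hP hne hD }

/-- Log-modularity at `univ` with `P \ A` and `Pᶜ \ A` removed. It reduces the odds at `A` to those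
at `A ∪ P`, where the cell `P` is complete. -/
theorem odds_mul_prob {P A : Finset Ω} (hP : P ∈ Q.parts) (hAP : (A ∩ P).Nonempty)
    (hA : (A \ P).Nonempty) :
    odds post P A * prob (post univ) P = revealedUpper post P (A ∩ P) * odds post P (A ∪ P) := by
  have hreg := hax.regularity
  have hPu := ne_univ_of_mem_parts hQ hP
  obtain ⟨x, hx⟩ := hAP
  obtain ⟨y, hy⟩ := hA
  rw [Finset.mem_inter] at hx
  rw [Finset.mem_sdiff] at hy
  have opos : ∀ B : Finset Ω, x ∈ B → y ∈ B → 0 < odds post P B := by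
    intro B hxB hyB
    rw [odds, ← prob_compl (hpost B ⟨x, hxB⟩)]
    exact div_pos (hreg.prob_pos hpost ⟨x, Finset.mem_inter.2 ⟨hxB, hx.2⟩⟩)
      (hreg.prob_pos hpost ⟨y, Finset.mem_inter.2 ⟨hyB, Finset.mem_compl.2 hy.2⟩⟩)
  have h := hax.log_modularity univ P (parts_eq_of_generating hgen ▸ hP)
    ⟨x, by simpa using hx.2⟩ ⟨y, by simpa using hy.2⟩ (P \ A) (Pᶜ \ A)
    ⟨by rw [Finset.univ_inter]; exact Finset.sdiff_subset, fun h =>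
      (Finset.mem_sdiff.1 (h (Finset.mem_inter.2 ⟨Finset.mem_univ x, hx.2⟩))).2 hx.1⟩
    ⟨by rw [Finset.univ_inter]; exact Finset.sdiff_subset, fun h =>
      (Finset.mem_sdiff.1 (h (Finset.mem_inter.2
        ⟨Finset.mem_univ y, Finset.mem_compl.2 hy.2⟩))).2 hy.1⟩
  have e1 : univ \ (P \ A ∪ Pᶜ \ A) = A := by
    ext z
    simp only [Finset.mem_sdiff, Finset.mem_union, Finset.mem_compl, Finset.mem_univ]
    tauto
  have e2 : univ \ (P \ A) = Pᶜ ∪ A ∩ P := by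
    ext z
    simp only [Finset.mem_sdiff, Finset.mem_union, Finset.mem_compl, Finset.mem_univ,
      Finset.mem_inter]
    tauto
  have e3 : univ \ (Pᶜ \ A) = A ∪ P := by
    ext z
    simp only [Finset.mem_sdiff, Finset.mem_union, Finset.mem_compl, Finset.mem_univ]
    tauto
  rw [e1, e2, e3] at h
  have o1 := opos univ (Finset.mem_univ x) (Finset.mem_univ y)
  have o2 := opos A hx.1 hy.1
  have o3 := opos (Pᶜ ∪ A ∩ P) (by simp [hx]) (by simp [hy])
  have o4 := opos (A ∪ P) (by simp [hx]) (by simp [hy])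
  rw [← Real.log_mul o1.ne' o2.ne', ← Real.log_mul o3.ne' o4.ne'] at h
  have h' := Real.log_injOn_pos (Set.mem_Ioi.2 (mul_pos o1 o2)) (Set.mem_Ioi.2 (mul_pos o3 o4)) h
  have hc : 0 < prob (post univ) Pᶜ :=
    hreg.prob_pos hpost ⟨y, by simpa using hy.2⟩
  have o5 : odds post P univ * prob (post univ) Pᶜ = prob (post univ) P := by
    rw [odds, ← prob_compl (hpost univ ⟨x, Finset.mem_univ x⟩), div_mul_cancel₀ _ hc.ne']
  rw [revealedUpper_eq_odds_mul hpost hPu, ← o5]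
  linear_combination prob (post univ) Pᶜ * h'

/-- Induction on the number of cells that `A` meets without containing. Completing one such cell
lowers the count, and `odds_mul_prob` carries the formula back. -/
theorem prob_cell_eq [Nonempty Ω] {A : Finset Ω} (hA : A.Nonempty) :
    ∀ P ∈ Q.parts,
      prob (post A) P = cellUpper post Q (A ∩ P) / total Q (cellUpper post Q) A := by
  have hreg := hax.regularity
  have hu := isUpper_cellUpper hax hpost hgen hQ
  set u := cellUpper post Q
  induction hn : #{P ∈ Q.parts | (A ∩ P).Nonempty ∧ ¬ P ⊆ A} using Nat.strong_induction_on
    generalizing A with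
  | _ n ih =>
    have ht := hu.total_pos hA
    have partial_cell : ∀ P ∈ Q.parts, ¬ P ⊆ A → prob (post A) P = u (A ∩ P) / total Q u A := by
      intro P hP hPA
      rcases (A ∩ P).eq_empty_or_nonempty with hemp | hne
      · rw [prob_inter_of_support (fun ω hω => hreg.eq_zero hpost hA hω), hemp, prob_empty,
          hu.empty, zero_div]
      have hX := hu.pos hP Finset.inter_subset_right hne
      rcases (A \ P).eq_empty_or_nonempty with hemp' | hne'
      · have hAP : A ⊆ P := Finset.sdiff_eq_empty_iff_subset.1 hemp'
        have hr : rest Q u P A = 0 := Finset.sum_eq_zero fun P' hP' => by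
          have hd : A ∩ P' = ∅ := Finset.disjoint_iff_inter_eq_empty.1
            ((Q.disjoint hP (Finset.mem_of_mem_erase hP')
              (Finset.ne_of_mem_erase hP').symm).mono_left hAP)
          rw [hd, hu.empty]
        rw [total_eq_add_rest hP, hr, add_zero, div_self hX.ne',
          prob_inter_of_support (fun ω hω => hreg.eq_zero hpost hA hω),
          Finset.inter_eq_left.2 hAP, (hreg A hA).2]
      · have hA' : (A ∪ P).Nonempty := hA.mono Finset.subset_union_left
        have hlt : #{P' ∈ Q.parts | ((A ∪ P) ∩ P').Nonempty ∧ ¬ P' ⊆ A ∪ P} < n := by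
          rw [← hn]
          refine Finset.card_lt_card ⟨fun P' hP' => ?_, fun h => ?_⟩
          · rw [Finset.mem_filter] at hP' ⊢
            obtain ⟨hP'Q, ⟨x, hx⟩, hns⟩ := hP'
            rw [Finset.mem_inter, Finset.mem_union] at hx
            refine ⟨hP'Q, ⟨x, Finset.mem_inter.2 ⟨hx.1.resolve_right fun hxP => ?_, hx.2⟩⟩,
              fun h => hns (h.trans Finset.subset_union_left)⟩
            rw [Q.eq_of_mem_parts hP'Q hP hx.2 hxP] at hns
            exact hns Finset.subset_union_right
          · have := h (Finset.mem_filter.2 ⟨hP, hne, hPA⟩)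
            exact (Finset.mem_filter.1 this).2.2 Finset.subset_union_right
        have h1 := ih _ hlt hA' rfl P hP
        have hr : rest Q u P (A ∪ P) = rest Q u P A :=
          rest_congr hP (Finset.union_sdiff_right A P)
        have hrpos := hu.rest_pos hne'
        have hp := prob_pos hu.full_support (Q.nonempty_of_mem_parts hP)
        have h2 : odds post P (A ∪ P) = prob (post univ) P / rest Q u P A := by
          rw [odds, h1, total_eq_add_rest hP, hr, Finset.inter_eq_right.2 Finset.subset_union_right,
            hu.cell P hP, one_sub_div (by positivity), add_sub_cancel_left,
            div_div_div_cancel_right₀ (by positivity)]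
        have h3 := odds_mul_prob hax hpost hgen hQ hP hne hne'
        rw [h2, ← cellUpper_eq hreg hpost hQ hP Finset.inter_subset_right] at h3
        have h4 : 0 < prob (post A) Pᶜ := by
          refine hreg.prob_pos hpost ?_
          rwa [← Finset.sdiff_eq_inter_compl]
        rw [prob_compl (hpost A hA)] at h4
        rw [odds] at h3
        rw [total_eq_add_rest hP, eq_div_iff (by positivity)]
        field_simp at h3
        linear_combination h3
    intro P hP
    by_cases hPA : P ⊆ A
    swap
    · exact partial_cell P hP hPA
    -- The union `F` of the complete cells is ideal. It receives the mass that the other cells leave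
    -- over, and the prior divides it among its cells.
    set S := Q.parts.filter (· ⊆ A) with hS
    set F := S.biUnion id with hF
    have hFA : F ⊆ A := Finset.biUnion_subset.2 fun P hP => (Finset.mem_filter.1 hP).2
    have hPF : P ⊆ F := Finset.subset_biUnion_of_mem id (Finset.mem_filter.2 ⟨hP, hPA⟩)
    have hideal : IsIdealEvent post F :=
      ((hgen F).2 ⟨S, Finset.filter_subset _ _, rfl⟩).1
    have hsum : ∀ q : Ω → ℝ, prob q F = ∑ P ∈ S, prob q P := fun q =>
      Finset.sum_biUnion fun P hP P' hP' hne =>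
        Q.disjoint (Finset.mem_filter.1 hP).1 (Finset.mem_filter.1 hP').1 hne
    have h1 := hideal.prob_eq_prob_mul hreg hpost hFA hPF
    have h2 : prob (post A) F + ∑ P ∈ Q.parts.filter (¬ · ⊆ A), prob (post A) P = 1 := by
      rw [hsum, hS, Finset.sum_filter_add_sum_filter_not, ← prob_univ (hpost A hA),
        prob_eq_sum_parts Q (post A) univ]
      simp
    have h3 : prob (post univ) F + ∑ P ∈ Q.parts.filter (¬ · ⊆ A), u (A ∩ P) = total Q u A := by
      have : prob (post univ) F = ∑ P ∈ S, u (A ∩ P) := by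
        rw [hsum]
        refine Finset.sum_congr rfl fun P hP => ?_
        rw [hS, Finset.mem_filter] at hP
        rw [Finset.inter_eq_right.2 hP.2, hu.cell P hP.1]
      rw [this, hS, Finset.sum_filter_add_sum_filter_not, total]
    have h4 : ∑ P ∈ Q.parts.filter (¬ · ⊆ A), prob (post A) P =
        (∑ P ∈ Q.parts.filter (¬ · ⊆ A), u (A ∩ P)) / total Q u A := by
      rw [Finset.sum_div]
      refine Finset.sum_congr rfl fun P hP => ?_
      rw [Finset.mem_filter] at hP
      exact partial_cell P hP.1 hP.2
    have hpF : 0 < prob (post univ) F :=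
      prob_pos hu.full_support ((Q.nonempty_of_mem_parts hP).mono hPF)
    have h5 : prob (post A) F = prob (post univ) F / total Q u A := by
      rw [h4] at h2
      rw [eq_div_iff ht.ne']
      field_simp at h2
      linarith
    rw [h1, h5, Finset.inter_eq_right.2 hPA, hu.cell P hP]
    field_simp

theorem represents_cellUpper [Nonempty Ω] :
    Represents post (post univ) Q (cellUpper post Q) := by
  have hreg := hax.regularity
  intro A hA
  refine ⟨fun ω hω => hreg.eq_zero hpost hA hω, fun P hP ω hω => ?_⟩
  rw [(hax.isIdealEvent_of_subset hgen hP Finset.inter_subset_right).eq_prob_mul hreg hpost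
    Finset.inter_subset_left hω, ← prob_cell_eq hax hpost hgen hQ hA P hP,
    prob_inter_of_support (fun ω hω => hreg.eq_zero hpost hA hω) P]

end Reveal

/-! ### The representation theorem -/

section Representation

variable [Nonempty Ω] {post : Finset Ω → Ω → ℝ}
  (hpost : ∀ A : Finset Ω, A.Nonempty → post A ∈ stdSimplex ℝ Ω)
include hpost

theorem SatisfiesAxioms.exists_isRichRML_greedySet (hax : SatisfiesAxioms post)
    (hne : revealedPartition post ≠ {univ}) :
    ∃ Q : Finpartition (univ : Finset Ω), (Q.parts : Set (Finset Ω)) = revealedPartition post ∧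
      IsRichRML post (post univ) Q (greedySet post) := by
  obtain ⟨Q, hgen⟩ := exists_partition_generating hpost hax.algebra
  have hparts := parts_eq_of_generating hgen
  have hQ : Q.parts ≠ {univ} := fun h => hne (by rw [← hparts, h, Finset.coe_singleton])
  have hu := isUpper_cellUpper hax hpost hgen hQ
  refine ⟨Q, hparts, ?_⟩
  rw [greedySet_eq_basePolytope hu hparts fun P hP D hD =>
    (cellUpper_eq hax.regularity hpost hQ hP hD).symm]
  exact hu.isRichRML_basePolytope (represents_cellUpper hax hpost hgen hQ)

/-- Idealness makes every event ideal, hence symmetrically ideal, and minimality of `univ` then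
leaves room for one state only. -/
theorem SatisfiesAxioms.subsingleton (hax : SatisfiesAxioms post)
    (h : revealedPartition post = {univ}) (ω : Ω) : {ω} = (univ : Finset Ω) := by
  have huniv : IsIdealEvent post univ := by
    intro A hA hE ω _
    obtain rfl : A = univ := Finset.univ_subset_iff.1 hE
    rw [bayes_univ (hpost univ hA)]
  have hideal : ∀ D : Finset Ω, IsIdealEvent post D := by
    intro D
    rcases eq_or_ssubset_of_subset (Finset.subset_univ D) with rfl | hD
    · exact huniv
    · exact hax.idealness univ (by simp [h]) D hD
  have hmin : Minimal (fun E => E.Nonempty ∧ IsSymmIdeal post E) (univ : Finset Ω) := by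
    have : (univ : Finset Ω) ∈ revealedPartition post := by simp [h]
    exact this
  exact Finset.univ_subset_iff.1
    (hmin.2 ⟨Finset.singleton_nonempty ω, hideal _, hideal _⟩ (Finset.subset_univ _))

theorem SatisfiesAxioms.exists_isRichRML (hax : SatisfiesAxioms post) :
    ∃ (p : Ω → ℝ) (Q : Finpartition (univ : Finset Ω)) (N : Set (Ω → ℝ)),
      IsRichRML post p Q N := by
  by_cases h : revealedPartition post = {univ}
  · have huniv := hpost univ Finset.univ_nonempty
    refine ⟨post univ, ⊥, {post univ}, isRichRML_bayes huniv
      (fun ω => (hax.regularity univ Finset.univ_nonempty).1 ω (Finset.mem_univ ω))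
      fun A hA => ?_⟩
    obtain ⟨ω, hω⟩ := hA
    have : A = univ := Finset.univ_subset_iff.1
      ((hax.subsingleton hpost h ω).ge.trans (Finset.singleton_subset_iff.2 hω))
    rw [this, bayes_univ huniv]
  · obtain ⟨Q, -, hQ⟩ := hax.exists_isRichRML_greedySet hpost h
    exact ⟨_, _, _, hQ⟩

/-- The upper probability of `N` is the revealed one, and a rich `N` is the base polytope of its
upper probability. -/
theorem IsRichRML.identification {p : Ω → ℝ} {Q : Finpartition (univ : Finset Ω)}
    {N : Set (Ω → ℝ)} (hQ : Q.parts ≠ {univ}) (h : IsRichRML post p Q N) :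
    p = post univ ∧ (Q.parts : Set (Finset Ω)) = revealedPartition post ∧ N = greedySet post := by
  have hu := h.2.isUpper h.1.consistent
  have hr := h.represents
  have hparts := parts_eq_of_generating
    (hr.generates hu (hr.regularity hu hpost) fun P hP _ _ _ => by
      have := ne_univ_of_mem_parts hQ hP
      rwa [Ne, Finset.eq_univ_iff_forall, not_forall] at this)
  refine ⟨hr.prior_eq hu, hparts, ?_⟩
  rw [h.2.eq_basePolytope h.1.consistent, greedySet_eq_basePolytope hu hparts fun P hP D hD =>
    hr.revealedUpper_eq hu hpost hP (ne_univ_of_mem_parts hQ hP) hD]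

end Representation

end RMLUpdating

theorem theorem1 {Ω : Type*} [Fintype Ω] [DecidableEq Ω] [Nonempty Ω]
    (post : Finset Ω → Ω → ℝ) (hpost : ∀ A : Finset Ω, A.Nonempty → post A ∈ stdSimplex ℝ Ω) :
    -- characterization
    (SatisfiesAxioms post ↔
      ∃ (p : Ω → ℝ) (Q : Finpartition (univ : Finset Ω)) (N : Set (Ω → ℝ)),
        IsRichRML post p Q N) ∧
    -- uniqueness
    (∀ (p p' : Ω → ℝ) (Q Q' : Finpartition (univ : Finset Ω)) (N N' : Set (Ω → ℝ)),
      Q.parts ≠ {univ} → Q'.parts ≠ {univ} →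
      IsRichRML post p Q N → IsRichRML post p' Q' N' → p = p' ∧ Q = Q' ∧ N = N') ∧
    -- identification
    (∀ (p : Ω → ℝ) (Q : Finpartition (univ : Finset Ω)) (N : Set (Ω → ℝ)),
      Q.parts ≠ {univ} → IsRichRML post p Q N →
      p = post univ ∧ (Q.parts : Set (Finset Ω)) = revealedPartition post ∧
        N = greedySet post) ∧
    -- construction
    (SatisfiesAxioms post → revealedPartition post ≠ {univ} →
      ∃ Q : Finpartition (univ : Finset Ω), (Q.parts : Set (Finset Ω)) = revealedPartition post ∧
        IsRichRML post (post univ) Q (greedySet post)) := by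
  refine ⟨⟨fun hax => hax.exists_isRichRML hpost, fun ⟨_, _, _, h⟩ => h.satisfiesAxioms hpost⟩,
    fun p p' Q Q' N N' hQ hQ' h h' => ?_, fun _ _ _ hQ h => h.identification hpost hQ,
    fun hax hne => hax.exists_isRichRML_greedySet hpost hne⟩
  obtain ⟨hp, hparts, hN⟩ := h.identification hpost hQ
  obtain ⟨hp', hparts', hN'⟩ := h'.identification hpost hQ'
  exact ⟨hp.trans hp'.symm, Finpartition.ext (Finset.coe_injective (hparts.trans hparts'.symm)),
    hN.trans hN'.symm⟩
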